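/- Let $C^1[0,\infty)$ denote the complex-valued functions that are continuously differentiable on $[0,\infty)$ (one-sided at $0$), and for $\tau\in C^1[0,\infty)$ with $\tau'(x)=o(1)$ as $x\to\infty$ write $\mathcal L\{\tau;s\}=\int_0^\infty \tau(x)e^{-sx}\,dx$ for $\Re s>0$. For $\beta\in[-\infty,0)$ let $V_\beta$ be the space of all $\tau\in C^1[0,\infty)$ with $\tau'(x)=o(1)$ as $x\to\infty$ such that $\mathcal L\{\tau;s\}$ has an analytic extension to $\{s\in\mathbb C:\Re s>\beta\}$ (for $\beta=-\infty$: an extension to an entire function). For $\alpha<0$ and $r>0$ let $R_{\alpha,r}=\{s\in\mathbb C:\alpha<\Re s<1,\ |\Im s|<r\}$, and let $V_{\alpha,r}$ be the space of all $\tau\in C^1[0,\infty)$ with $\tau'(x)=o(1)$ as $x\to\infty$ such that $\mathcal L\{\tau;s\}$ has an analytic continuation to $R_{\alpha,r}$ and a continuous extension to the closed rectangle $\overline{R}_{\alpha,r}$, normed by $$\|\tau\|_{\alpha,r}=\|\tau'\|_{L^\infty}+\sup_{s\in\overline{R}_{\alpha,r}}|\mathcal L\{\tau;s\}|,$$ where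 $\mathcal L\{\tau;s\}$ also denotes the extended function. The space $V_\beta$ carries the locally convex topology generated by the norms $\|\cdot\|_{\alpha,r}$ with $\beta<\alpha<0$ and $r>0$. One has $V_{-\infty}\subseteq V_\alpha$ and $V_{-\infty}\subseteq V_{\alpha,r}$ for all $\alpha<0$ and $r>0$. Theorem. For every $\alpha<0$ and every $r>0$, the space $V_{-\infty}$ is dense in $V_{\alpha,r}$. For every $\alpha<0$, the space $V_{-\infty}$ is dense in $V_\alpha$. -/

import Mathlib

open Set Filter Topology MeasureTheory
open scoped NNReal

namespace LaplaceDensity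

/-! Functions on the half-line `[0, ∞)`, and their derivative and Laplace transform -/

/-- A function `τ` on `[0, ∞)`, read as a function on `ℝ` (constant on `(-∞, 0]`; only its values
on `[0, ∞)` are ever used). -/
def onReal (τ : ℝ≥0 → ℂ) : ℝ → ℂ := fun x => τ x.toNNReal

/-- The derivative `τ'(x)`, `x ≥ 0` (the right derivative at `x = 0`). -/
noncomputable def hderiv (τ : ℝ≥0 → ℂ) (x : ℝ) : ℂ := derivWithin (onReal τ) (Ici 0) x

/-- `τ ∈ C¹[0, ∞)` with `τ'(x) = o(1)` as `x → ∞`. -/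
def IsSlow (τ : ℝ≥0 → ℂ) : Prop :=
  ContDiffOn ℝ 1 (onReal τ) (Ici 0) ∧ Tendsto (hderiv τ) atTop (𝓝 0)

/-- The Laplace integral `∫₀^∞ τ(x) e^{-sx} dx`. It converges absolutely for `Re s > 0`
if `IsSlow τ`, and it is only used there. -/
noncomputable def laplace (τ : ℝ≥0 → ℂ) (s : ℂ) : ℂ :=
  ∫ x in Ioi (0 : ℝ), onReal τ x * Complex.exp (-s * x)

/-- The open half-plane `{s | Re s > β}`, for `β ∈ [-∞, ∞]`. -/
def halfPlane (β : EReal) : Set ℂ := {s | β < (s.re : EReal)}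

/-- The open rectangle `R_{α,r} = {s | α < Re s < 1, |Im s| < r}`. -/
def rect (α r : ℝ) : Set ℂ := {s | α < s.re ∧ s.re < 1 ∧ |s.im| < r}

/-- `F` is an analytic extension of the Laplace transform of `τ` to `{s | Re s > β}`. -/
def IsHalfPlaneExt (β : EReal) (τ : ℝ≥0 → ℂ) (F : ℂ → ℂ) : Prop :=
  DifferentiableOn ℂ F (halfPlane β) ∧
    ∀ s ∈ halfPlane β, 0 < s.re → F s = laplace τ s

/-- `F` is an analytic continuation of the Laplace transform of `τ` to the open rectangle
`R_{α,r}`, together with a continuous extension to the closed rectangle. -/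
def IsRectExt (α r : ℝ) (τ : ℝ≥0 → ℂ) (F : ℂ → ℂ) : Prop :=
  DifferentiableOn ℂ F (rect α r) ∧ ContinuousOn F (closure (rect α r)) ∧
    ∀ s ∈ rect α r, 0 < s.re → F s = laplace τ s

open Classical in
/-- The continuation of the Laplace transform of `τ` to the closed rectangle. Its values on
`closure (rect α r)` are unique (see `IsRectExt.eqOn`). -/
noncomputable def rectExt (α r : ℝ) (τ : ℝ≥0 → ℂ) : ℂ → ℂ :=
  if h : ∃ F, IsRectExt α r τ F then h.choose else 0

/-- `‖τ‖_{α,r} = ‖τ'‖_∞ + sup_{s ∈ closure R_{α,r}} |𝓛{τ; s}|`. -/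
noncomputable def rectNorm (α r : ℝ) (τ : ℝ≥0 → ℂ) : ℝ :=
  (⨆ x : ℝ≥0, ‖hderiv τ x‖) + ⨆ s : closure (rect α r), ‖rectExt α r τ s‖

/-! Basic facts -/

lemma IsSlow.differentiableOn {τ : ℝ≥0 → ℂ} (h : IsSlow τ) :
    DifferentiableOn ℝ (onReal τ) (Ici 0) := h.1.differentiableOn (by norm_num)

lemma hderiv_add {τ σ : ℝ≥0 → ℂ} (h : IsSlow τ) (h' : IsSlow σ) {x : ℝ} (hx : 0 ≤ x) :
    hderiv (τ + σ) x = hderiv τ x + hderiv σ x :=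
  derivWithin_add (h.differentiableOn x hx) (h'.differentiableOn x hx)

lemma hderiv_smul (c : ℂ) {τ : ℝ≥0 → ℂ} (h : IsSlow τ) {x : ℝ} (hx : 0 ≤ x) :
    hderiv (c • τ) x = c * hderiv τ x :=
  derivWithin_const_mul c (h.differentiableOn x hx)

lemma isSlow_zero : IsSlow 0 := by
  have h0 : onReal 0 = fun _ => (0 : ℂ) := rfl
  refine ⟨by rw [h0]; exact contDiffOn_const, ?_⟩
  have : hderiv 0 = fun _ => (0 : ℂ) := by
    funext x; simp [hderiv, h0]
  rw [this]; exact tendsto_const_nhds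

lemma IsSlow.add {τ σ : ℝ≥0 → ℂ} (h : IsSlow τ) (h' : IsSlow σ) : IsSlow (τ + σ) := by
  refine ⟨h.1.add h'.1, ?_⟩
  have := h.2.add h'.2
  rw [add_zero] at this
  refine this.congr' ?_
  filter_upwards [eventually_ge_atTop 0] with x hx using (hderiv_add h h' hx).symm

lemma IsSlow.smul (c : ℂ) {τ : ℝ≥0 → ℂ} (h : IsSlow τ) : IsSlow (c • τ) := by
  refine ⟨contDiffOn_const.mul h.1, ?_⟩
  have := h.2.const_mul c
  rw [mul_zero] at this
  refine this.congr' ?_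
  filter_upwards [eventually_ge_atTop 0] with x hx using (hderiv_smul c h hx).symm

lemma IsSlow.exists_bound {τ : ℝ≥0 → ℂ} (h : IsSlow τ) :
    ∃ M, ∀ x : ℝ, 0 ≤ x → ‖hderiv τ x‖ ≤ M := by
  have hc : ContinuousOn (hderiv τ) (Ici 0) :=
    h.1.continuousOn_derivWithin (uniqueDiffOn_Ici 0) le_rfl
  obtain ⟨N, hN⟩ := (h.2.norm.eventually_le_const (u := 1) (by simp)).exists_forall_of_atTop
  obtain ⟨C, hC⟩ := isCompact_Icc.exists_bound_of_continuousOn (hc.mono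
    (Icc_subset_Ici_self : Icc (0 : ℝ) N ⊆ Ici 0))
  refine ⟨max C 1, fun x hx => ?_⟩
  rcases le_total x N with hxN | hxN
  · exact (hC x ⟨hx, hxN⟩).trans (le_max_left _ _)
  · exact (hN x hxN).trans (le_max_right _ _)

lemma IsSlow.bddAbove {τ : ℝ≥0 → ℂ} (h : IsSlow τ) :
    BddAbove (range fun x : ℝ≥0 => ‖hderiv τ x‖) := by
  obtain ⟨M, hM⟩ := h.exists_bound
  exact ⟨M, by rintro _ ⟨x, rfl⟩; exact hM x x.2⟩

lemma IsSlow.integrableOn {τ : ℝ≥0 → ℂ} (h : IsSlow τ) {s : ℂ} (hs : 0 < s.re) :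
    IntegrableOn (fun x : ℝ => onReal τ x * Complex.exp (-s * x)) (Ioi 0) := by
  obtain ⟨M, hM⟩ := h.exists_bound
  have hM0 : 0 ≤ M := (norm_nonneg _).trans (hM 0 le_rfl)
  set A := ‖onReal τ 0‖ with hA
  have hgrow : ∀ x : ℝ, 0 ≤ x → ‖onReal τ x‖ ≤ A + M * x := by
    intro x hx
    have := Convex.norm_image_sub_le_of_norm_derivWithin_le h.differentiableOn
      (fun y hy => hM y hy) (convex_Ici 0) (mem_Ici.2 le_rfl) (mem_Ici.2 hx)
    rw [sub_zero, Real.norm_of_nonneg hx] at this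
    have h2 := norm_sub_norm_le (onReal τ x) (onReal τ 0)
    linarith
  have hcont : ContinuousOn (fun x : ℝ => onReal τ x * Complex.exp (-s * x)) (Ici 0) :=
    h.1.continuousOn.mul (by fun_prop)
  have hdom : IntegrableOn
      (fun x : ℝ => (A + M * x) * Real.exp (-s.re * x)) (Ioi 0) := by
    refine integrable_of_isBigO_exp_neg (half_pos hs) (by fun_prop) ?_
    have h1 : (fun x : ℝ => A + M * x) =O[atTop] fun x => Real.exp (s.re / 2 * x) := by
      have hlin : (fun x : ℝ => x) =O[atTop] fun x => Real.exp (s.re / 2 * x) := by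
        have := (isLittleO_pow_exp_pos_mul_atTop 1 (half_pos hs)).isBigO
        simpa using this
      have hone : (fun _ : ℝ => A) =O[atTop] fun x => Real.exp (s.re / 2 * x) := by
        have := (isLittleO_pow_exp_pos_mul_atTop 0 (half_pos hs)).isBigO
        simpa using this.const_mul_left A
      exact hone.add (hlin.const_mul_left M)
    have h2 := h1.mul (Asymptotics.isBigO_refl (fun x : ℝ => Real.exp (-s.re * x)) atTop)
    refine h2.congr_right fun x => ?_
    rw [← Real.exp_add]
    congr 1
    ring
  refine Integrable.mono' hdom
    ((hcont.mono Ioi_subset_Ici_self).aestronglyMeasurable measurableSet_Ioi) ?_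
  filter_upwards [ae_restrict_mem measurableSet_Ioi] with x hx
  rw [norm_mul, Complex.norm_exp]
  have : (-s * (x : ℂ)).re = -s.re * x := by simp
  rw [this]
  exact mul_le_mul_of_nonneg_right (hgrow x (le_of_lt hx)) (Real.exp_pos _).le

lemma laplace_add {τ σ : ℝ≥0 → ℂ} (h : IsSlow τ) (h' : IsSlow σ) {s : ℂ} (hs : 0 < s.re) :
    laplace (τ + σ) s = laplace τ s + laplace σ s := by
  unfold laplace
  rw [← integral_add (h.integrableOn hs) (h'.integrableOn hs)]
  congr 1
  funext x
  simp [onReal, add_mul]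

lemma laplace_smul (c : ℂ) (τ : ℝ≥0 → ℂ) (s : ℂ) : laplace (c • τ) s = c * laplace τ s := by
  unfold laplace
  rw [← integral_const_mul]
  congr 1
  funext x
  simp [onReal, mul_assoc]

lemma laplace_zero (s : ℂ) : laplace 0 s = 0 := by simp [laplace, onReal]

lemma rect_eq (α r : ℝ) : rect α r = Ioo α 1 ×ℂ Ioo (-r) r := by
  ext s
  simp [rect, Complex.mem_reProdIm, abs_lt, and_assoc]

lemma isOpen_rect (α r : ℝ) : IsOpen (rect α r) := by
  rw [rect_eq]; exact isOpen_Ioo.reProdIm isOpen_Ioo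

lemma convex_rect (α r : ℝ) : Convex ℝ (rect α r) := by
  rw [rect_eq]
  exact ((convex_Ioo α 1).is_linear_preimage Complex.reLm.isLinear).inter
    ((convex_Ioo (-r) r).is_linear_preimage Complex.imLm.isLinear)

lemma isCompact_closure_rect (α r : ℝ) : IsCompact (closure (rect α r)) := by
  rw [rect_eq]
  exact ((Metric.isBounded_Ioo α 1).reProdIm (Metric.isBounded_Ioo (-r) r)).isCompact_closure

/-- For the parameters used below, the closed rectangle is given by the non-strict inequalities. -/
lemma closure_rect {α r : ℝ} (hα : α < 0) (hr : 0 < r) :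
    closure (rect α r) = {s | α ≤ s.re ∧ s.re ≤ 1 ∧ |s.im| ≤ r} := by
  rw [rect_eq, Complex.closure_reProdIm, closure_Ioo (by linarith), closure_Ioo (by linarith)]
  ext s
  simp [Complex.mem_reProdIm, abs_le, and_assoc]

/-- Uniqueness of the continuation on the closed rectangle. -/
lemma IsRectExt.eqOn {α r : ℝ} {τ : ℝ≥0 → ℂ} {F G : ℂ → ℂ}
    (hF : IsRectExt α r τ F) (hG : IsRectExt α r τ G) : EqOn F G (closure (rect α r)) := by
  have key : EqOn F G (rect α r) := by
    intro s hs
    obtain ⟨h1, h2, h3⟩ := hs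
    set m : ℝ := max α 0 with hm
    have hα1 : α < 1 := h1.trans h2
    have hm1 : m < 1 := max_lt hα1 one_pos
    have hm0 : 0 ≤ m := le_max_right _ _
    have hmα : α ≤ m := le_max_left _ _
    have hr : 0 < r := (abs_nonneg _).trans_lt h3
    set z : ℂ := (((m + 1) / 2 : ℝ) : ℂ) with hz
    have hzre : z.re = (m + 1) / 2 := by rw [hz, Complex.ofReal_re]
    have hzim : z.im = 0 := by rw [hz, Complex.ofReal_im]
    have hzr : z ∈ rect α r := by
      refine ⟨?_, ?_, ?_⟩
      · rw [hzre]; linarith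
      · rw [hzre]; linarith
      · rw [hzim, abs_zero]; exact hr
    have hev : F =ᶠ[𝓝 z] G := by
      have ho : IsOpen (rect α r ∩ {w : ℂ | 0 < w.re}) :=
        (isOpen_rect α r).inter (isOpen_lt continuous_const Complex.continuous_re)
      have hz0 : 0 < z.re := by rw [hzre]; linarith
      filter_upwards [ho.mem_nhds ⟨hzr, hz0⟩] with w hw
      rw [hF.2.2 w hw.1 hw.2, hG.2.2 w hw.1 hw.2]
    exact (hF.1.analyticOnNhd (isOpen_rect α r)).eqOn_of_preconnected_of_eventuallyEq
      (hG.1.analyticOnNhd (isOpen_rect α r)) (convex_rect α r).isPreconnected hzr hev ⟨h1, h2, h3⟩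
  exact key.of_subset_closure hF.2.1 hG.2.1 subset_closure subset_rfl

lemma IsRectExt.rectExt {α r : ℝ} {τ : ℝ≥0 → ℂ} {F : ℂ → ℂ} (hF : IsRectExt α r τ F) :
    IsRectExt α r τ (rectExt α r τ) := by
  have h : ∃ F, IsRectExt α r τ F := ⟨F, hF⟩
  rw [LaplaceDensity.rectExt, dif_pos h]
  exact h.choose_spec

lemma IsRectExt.rectExt_eqOn {α r : ℝ} {τ : ℝ≥0 → ℂ} {F : ℂ → ℂ} (hF : IsRectExt α r τ F) :
    EqOn (LaplaceDensity.rectExt α r τ) F (closure (rect α r)) :=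
  hF.rectExt.eqOn hF

lemma isRectExt_zero (α r : ℝ) : IsRectExt α r 0 0 :=
  ⟨differentiableOn_const 0, continuousOn_const, fun s _ _ => (laplace_zero s).symm⟩

lemma IsRectExt.add {α r : ℝ} {τ σ : ℝ≥0 → ℂ} {F G : ℂ → ℂ} (h : IsSlow τ) (h' : IsSlow σ)
    (hF : IsRectExt α r τ F) (hG : IsRectExt α r σ G) : IsRectExt α r (τ + σ) (F + G) :=
  ⟨hF.1.add hG.1, hF.2.1.add hG.2.1, fun s hs h0 => by
    rw [laplace_add h h' h0, ← hF.2.2 s hs h0, ← hG.2.2 s hs h0]; rfl⟩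

lemma IsRectExt.smul {α r : ℝ} (c : ℂ) {τ : ℝ≥0 → ℂ} {F : ℂ → ℂ}
    (hF : IsRectExt α r τ F) : IsRectExt α r (c • τ) (c • F) :=
  ⟨hF.1.const_smul c, hF.2.1.const_smul c, fun s hs h0 => by
    rw [laplace_smul, ← hF.2.2 s hs h0]; rfl⟩

lemma IsHalfPlaneExt.isRectExt {β : EReal} {α : ℝ} (hβ : β < (α : EReal)) (r : ℝ)
    {τ : ℝ≥0 → ℂ} {F : ℂ → ℂ} (hF : IsHalfPlaneExt β τ F) : IsRectExt α r τ F := by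
  have hcl : closure (rect α r) ⊆ halfPlane β := by
    have h1 : closure (rect α r) ⊆ {s : ℂ | α ≤ s.re} :=
      closure_minimal (fun s hs => hs.1.le) (isClosed_le continuous_const Complex.continuous_re)
    intro s hs
    exact hβ.trans_le (EReal.coe_le_coe_iff.2 (h1 hs))
  exact ⟨hF.1.mono (subset_closure.trans hcl), hF.1.continuousOn.mono hcl,
    fun s hs => hF.2 s (hcl (subset_closure hs))⟩

/-! The spaces -/

/-- `V_{α,r}` as a linear space: all `τ ∈ C¹[0, ∞)` with `τ' = o(1)` whose Laplace transform has
an analytic continuation to `R_{α,r}` and a continuous extension to the closed rectangle. -/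
def rectSubmodule (α r : ℝ) : Submodule ℂ (ℝ≥0 → ℂ) where
  carrier := {τ | IsSlow τ ∧ ∃ F, IsRectExt α r τ F}
  add_mem' := by
    rintro τ σ ⟨h, F, hF⟩ ⟨h', G, hG⟩
    exact ⟨h.add h', F + G, hF.add h h' hG⟩
  zero_mem' := ⟨isSlow_zero, 0, isRectExt_zero α r⟩
  smul_mem' := by
    rintro c τ ⟨h, F, hF⟩
    exact ⟨h.smul c, c • F, hF.smul c⟩

/-- `V_β` as a linear space: all `τ ∈ C¹[0, ∞)` with `τ' = o(1)` whose Laplace transform has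
an analytic extension to `{s | Re s > β}`; for `β = ⊥ = -∞` this means an entire extension. -/
def halfPlaneSubmodule (β : EReal) : Submodule ℂ (ℝ≥0 → ℂ) where
  carrier := {τ | IsSlow τ ∧ ∃ F, IsHalfPlaneExt β τ F}
  add_mem' := by
    rintro τ σ ⟨h, F, hF⟩ ⟨h', G, hG⟩
    refine ⟨h.add h', F + G, hF.1.add hG.1, fun s hs h0 => ?_⟩
    rw [laplace_add h h' h0, ← hF.2 s hs h0, ← hG.2 s hs h0]; rfl
  zero_mem' := ⟨isSlow_zero, 0, differentiableOn_const 0, fun s _ _ => (laplace_zero s).symm⟩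
  smul_mem' := by
    rintro c τ ⟨h, F, hF⟩
    refine ⟨h.smul c, c • F, hF.1.const_smul c, fun s hs h0 => ?_⟩
    rw [laplace_smul, ← hF.2 s hs h0]; rfl

lemma halfPlaneSubmodule_le_rectSubmodule {β : EReal} {α : ℝ} (hβ : β < (α : EReal)) (r : ℝ) :
    halfPlaneSubmodule β ≤ rectSubmodule α r :=
  fun _ hτ => ⟨hτ.1, hτ.2.imp fun _ hF => hF.isRectExt hβ r⟩

lemma halfPlaneSubmodule_mono {β₁ β₂ : EReal} (h : β₁ ≤ β₂) :
    halfPlaneSubmodule β₁ ≤ halfPlaneSubmodule β₂ := by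
  have hsub : halfPlane β₂ ⊆ halfPlane β₁ := fun s hs => h.trans_lt hs
  exact fun _ hτ => ⟨hτ.1, hτ.2.imp fun _ hF => ⟨hF.1.mono hsub, fun s hs => hF.2 s (hsub hs)⟩⟩

lemma bddAbove_rectExt {α r : ℝ} {τ : ℝ≥0 → ℂ} (h : τ ∈ rectSubmodule α r) :
    BddAbove (range fun s : closure (rect α r) => ‖rectExt α r τ s‖) := by
  obtain ⟨F, hF⟩ := h.2
  obtain ⟨C, hC⟩ := (isCompact_closure_rect α r).exists_bound_of_continuousOn hF.rectExt.2.1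
  exact ⟨C, by rintro _ ⟨s, rfl⟩; exact hC s s.2⟩

lemma rectNorm_nonneg (α r : ℝ) (τ : ℝ≥0 → ℂ) : 0 ≤ rectNorm α r τ :=
  add_nonneg (Real.iSup_nonneg fun _ => norm_nonneg _) (Real.iSup_nonneg fun _ => norm_nonneg _)

lemma rectNorm_add_le {α r : ℝ} {τ σ : ℝ≥0 → ℂ} (h : τ ∈ rectSubmodule α r)
    (h' : σ ∈ rectSubmodule α r) :
    rectNorm α r (τ + σ) ≤ rectNorm α r τ + rectNorm α r σ := by
  have h1 : (⨆ x : ℝ≥0, ‖hderiv (τ + σ) x‖) ≤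
      (⨆ x : ℝ≥0, ‖hderiv τ x‖) + ⨆ x : ℝ≥0, ‖hderiv σ x‖ := by
    refine ciSup_le fun x => ?_
    rw [hderiv_add h.1 h'.1 x.coe_nonneg]
    exact (norm_add_le _ _).trans (add_le_add (le_ciSup h.1.bddAbove x) (le_ciSup h'.1.bddAbove x))
  have h2 : (⨆ s : closure (rect α r), ‖rectExt α r (τ + σ) s‖) ≤
      (⨆ s : closure (rect α r), ‖rectExt α r τ s‖) +
        ⨆ s : closure (rect α r), ‖rectExt α r σ s‖ := by
    refine Real.iSup_le (fun s => ?_) (add_nonneg (Real.iSup_nonneg fun _ => norm_nonneg _)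
      (Real.iSup_nonneg fun _ => norm_nonneg _))
    obtain ⟨F, hF⟩ := h.2
    obtain ⟨G, hG⟩ := h'.2
    rw [(hF.rectExt.add h.1 h'.1 hG.rectExt).rectExt_eqOn s.2]
    exact (norm_add_le _ _).trans
      (add_le_add (le_ciSup (bddAbove_rectExt h) s) (le_ciSup (bddAbove_rectExt h') s))
  unfold rectNorm
  linarith

lemma rectNorm_smul {α r : ℝ} (c : ℂ) {τ : ℝ≥0 → ℂ} (h : τ ∈ rectSubmodule α r) :
    rectNorm α r (c • τ) = ‖c‖ * rectNorm α r τ := by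
  obtain ⟨F, hF⟩ := h.2
  have h1 : (fun x : ℝ≥0 => ‖hderiv (c • τ) x‖) = fun x : ℝ≥0 => ‖c‖ * ‖hderiv τ x‖ := by
    funext x; rw [hderiv_smul c h.1 x.coe_nonneg, norm_mul]
  have h2 : (fun s : closure (rect α r) => ‖rectExt α r (c • τ) s‖) =
      fun s : closure (rect α r) => ‖c‖ * ‖rectExt α r τ s‖ := by
    funext s; rw [(hF.rectExt.smul c).rectExt_eqOn s.2, Pi.smul_apply, norm_smul]
  unfold rectNorm
  rw [h1, h2, ← Real.mul_iSup_of_nonneg (norm_nonneg c), ← Real.mul_iSup_of_nonneg (norm_nonneg c),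
    mul_add]

lemma eq_zero_of_rectNorm {α r : ℝ} (hα : α < 0) (hr : 0 < r) {τ : ℝ≥0 → ℂ}
    (h : τ ∈ rectSubmodule α r) (h0 : rectNorm α r τ = 0) : τ = 0 := by
  obtain ⟨F, hF⟩ := h.2
  have hA : 0 ≤ ⨆ x : ℝ≥0, ‖hderiv τ x‖ := Real.iSup_nonneg fun _ => norm_nonneg _
  have hB : 0 ≤ ⨆ s : closure (rect α r), ‖rectExt α r τ s‖ :=
    Real.iSup_nonneg fun _ => norm_nonneg _
  unfold rectNorm at h0
  have hd : ∀ x : ℝ, 0 ≤ x → ‖hderiv τ x‖ ≤ 0 := fun x hx =>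
    (le_ciSup h.1.bddAbove ⟨x, hx⟩).trans (by linarith)
  have hconst : ∀ x : ℝ, 0 ≤ x → onReal τ x = onReal τ 0 := by
    intro x hx
    have := Convex.norm_image_sub_le_of_norm_derivWithin_le h.1.differentiableOn
      (fun y hy => hd y hy) (convex_Ici 0) (mem_Ici.2 le_rfl) (mem_Ici.2 hx)
    rw [zero_mul, norm_le_zero_iff, sub_eq_zero] at this
    exact this
  have hmem : (1 / 2 : ℂ) ∈ rect α r := by
    refine ⟨?_, ?_, ?_⟩ <;> norm_num <;> linarith
  have hL : laplace τ (1 / 2) = 0 := by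
    rw [← hF.rectExt.2.2 _ hmem (by norm_num), ← norm_le_zero_iff]
    exact (le_ciSup (bddAbove_rectExt h) ⟨_, subset_closure hmem⟩).trans (by linarith)
  have hL2 : laplace τ (1 / 2) = onReal τ 0 * 2 := by
    unfold laplace
    have : ∫ x in Ioi (0 : ℝ), onReal τ x * Complex.exp (-(1 / 2 : ℂ) * x) =
        ∫ x in Ioi (0 : ℝ), onReal τ 0 * Complex.exp (-(1 / 2 : ℂ) * x) :=
      setIntegral_congr_fun measurableSet_Ioi fun x hx => by
        simp only [hconst x (le_of_lt hx)]
    rw [this, integral_const_mul, integral_exp_mul_complex_Ioi (by norm_num)]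
    norm_num
  have hτ0 : onReal τ 0 = 0 := by
    rw [hL] at hL2
    simpa using hL2.symm
  funext x
  have := hconst x x.2
  rw [hτ0] at this
  simpa [onReal] using this

/-- The space `V_{α,r}`, for `α < 0` and `r > 0`; it carries the norm `‖·‖_{α,r}`. -/
def VRect (α r : ℝ) (_hα : α < 0) (_hr : 0 < r) : Type := rectSubmodule α r

/-- The space `V_β`, topologized below by the norms `‖·‖_{α,r}` with `β < α < 0` and `r > 0`. -/
def VHalf (β : EReal) : Type := halfPlaneSubmodule β

section instances

variable {α r : ℝ} {hα : α < 0} {hr : 0 < r} {β : EReal}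

instance : AddCommGroup (VRect α r hα hr) := inferInstanceAs (AddCommGroup (rectSubmodule α r))

instance : Module ℂ (VRect α r hα hr) := inferInstanceAs (Module ℂ (rectSubmodule α r))

instance : AddCommGroup (VHalf β) := inferInstanceAs (AddCommGroup (halfPlaneSubmodule β))

instance : Module ℂ (VHalf β) := inferInstanceAs (Module ℂ (halfPlaneSubmodule β))

noncomputable instance : Norm (VRect α r hα hr) := ⟨fun τ => rectNorm α r τ.1⟩

lemma VRect.normedSpaceCore : NormedSpace.Core ℂ (VRect α r hα hr) where
  norm_nonneg τ := rectNorm_nonneg α r τ.1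
  norm_smul c τ := rectNorm_smul c τ.2
  norm_triangle τ σ := rectNorm_add_le τ.2 σ.2
  norm_eq_zero_iff τ := by
    refine ⟨fun h => Subtype.ext (eq_zero_of_rectNorm hα hr τ.2 h), ?_⟩
    rintro rfl
    have := rectNorm_smul (0 : ℂ) (rectSubmodule α r).zero_mem
    rw [zero_smul, norm_zero, zero_mul] at this
    exact this

noncomputable instance : NormedAddCommGroup (VRect α r hα hr) :=
  NormedAddCommGroup.ofCore VRect.normedSpaceCore

noncomputable instance : NormedSpace ℂ (VRect α r hα hr) :=
  NormedSpace.ofCore VRect.normedSpaceCore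

end instances

/-- The inclusion `V_β ⊆ V_{α,r}`, for `β < α`. -/
def VHalf.toVRect {β : EReal} (α r : ℝ) (hα : α < 0) (hr : 0 < r) (h : β < (α : EReal)) :
    VHalf β →ₗ[ℂ] VRect α r hα hr :=
  Submodule.inclusion (halfPlaneSubmodule_le_rectSubmodule h r)

/-- The inclusion `V_{β₁} ⊆ V_{β₂}`, for `β₁ ≤ β₂`. -/
def VHalf.incl {β₁ β₂ : EReal} (h : β₁ ≤ β₂) : VHalf β₁ →ₗ[ℂ] VHalf β₂ :=
  Submodule.inclusion (halfPlaneSubmodule_mono h)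

/-- The topology of `V_β`: the coarsest one for which the inclusions into the normed spaces
`V_{α,r}`, `β < α < 0`, `r > 0`, are continuous, i.e. the locally convex topology generated by
the family of norms `‖·‖_{α,r}`. -/
noncomputable instance (β : EReal) : TopologicalSpace (VHalf β) :=
  ⨅ (α : ℝ) (r : ℝ) (hα : α < 0) (hr : 0 < r) (h : β < (α : EReal)),
    TopologicalSpace.induced (VHalf.toVRect α r hα hr h) inferInstance

end LaplaceDensity

/-! Let `M` be the closure of `V_{-∞}` in `V_{α,r}` (`entireClosure`). The building blocks are the
exponentials `x ↦ e^{zx}` with `Re z < 0` and `z` outside the closed rectangle, whose Laplace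
transform is `1 / (s - z)`. If `Re z < α`, then `e^{zx - εx²}` tends to `e^{zx}` in norm as `ε → 0`,
and these damped functions have entire transforms, so `e^{zx} ∈ M`. The map `z ↦ e^{zx}` is
holomorphic with values in `V_{α,r}`, so its image in `V_{α,r} / M` is holomorphic too. That image
vanishes for `Re z < α`, and by the identity theorem it vanishes for all admissible `z`, including
those above and below the rectangle (`expo_mem`).

Next, let `f` be a `C¹` function that is zero on the negative axis and decays exponentially, and let
its transform `F` continue past the closed rectangle. Laplace inversion on a line `Re z = -c`
expresses `2π f'(x)` through `z F(z) e^{zx}`. By Cauchy's theorem the part of the line that crosses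
the rectangle may be replaced by a detour around its left side. The new contour meets only
admissible exponentials, so `f` is a `V_{α,r}`-valued integral of elements of `M`
(`mem_entireClosure_of_decay`). Absolute convergence in norm needs decay of `z F(z)`. Averaging `f`
twice over short intervals supplies it, and the averages converge back to `f`
(`mem_entireClosure_of_boxAvg`).

A general `τ` is reduced to this case in two moves. Subtracting a Gaussian element of `V_{-∞}` makes
`τ` and `τ'` vanish at `0`. Then `τ` is replaced by `τ((1+δ)x) e^{-δx}`: its transform is that of
`τ` composed with a contraction towards `s = 1`, hence continues to a larger rectangle and across
the imaginary axis. As `δ → 0` these functions converge to `τ` in norm; the hypothesis `τ' = o(1)`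
is what makes the derivatives converge uniformly (`IsSlow.eventually_contractDeriv`).

For `V_α`, the norms increase with the rectangle, so countably many of them generate the topology,
and an approximant within `1/(n+1)` in the `n`-th norm gives a convergent sequence. -/

namespace LaplaceDensity

/-! Functions on the half-line given by restriction from `ℝ` -/

/-- The restriction to `[0, ∞)` of a function on `ℝ`. -/
def restrict (f : ℝ → ℂ) : ℝ≥0 → ℂ := fun x => f x

lemma onReal_restrict (f : ℝ → ℂ) {x : ℝ} (hx : 0 ≤ x) : onReal (restrict f) x = f x := by
  simp [onReal, restrict, Real.coe_toNNReal x hx]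

lemma restrict_onReal (τ : ℝ≥0 → ℂ) : restrict (onReal τ) = τ := by
  funext x; simp [onReal, restrict]

lemma restrict_sub (f g : ℝ → ℂ) : restrict f - restrict g = restrict (f - g) := rfl

lemma restrict_smul (c : ℂ) (f : ℝ → ℂ) : c • restrict f = restrict (c • f) := rfl

lemma hderiv_restrict {f : ℝ → ℂ} {f' : ℂ} {x : ℝ} (hx : 0 ≤ x)
    (h : HasDerivWithinAt f f' (Ici 0) x) : hderiv (restrict f) x = f' :=
  (h.congr (fun _ hy => onReal_restrict f hy) (onReal_restrict f hx)).derivWithin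
    (uniqueDiffOn_Ici 0 x hx)

lemma isSlow_restrict {f f' : ℝ → ℂ} (hd : ∀ x, 0 ≤ x → HasDerivWithinAt f (f' x) (Ici 0) x)
    (hc : ContinuousOn f' (Ici 0)) (ht : Tendsto f' atTop (𝓝 0)) : IsSlow (restrict f) := by
  refine ⟨(contDiffOn_one_iff_derivWithin (uniqueDiffOn_Ici 0)).2 ⟨fun x hx => ?_, ?_⟩, ?_⟩
  · exact ((hd x hx).congr (fun _ hy => onReal_restrict f hy)
      (onReal_restrict f hx)).differentiableWithinAt
  · exact hc.congr fun x hx => hderiv_restrict hx (hd x hx)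
  · refine ht.congr' ?_
    filter_upwards [eventually_ge_atTop 0] with x hx using (hderiv_restrict hx (hd x hx)).symm

/-! ### Laplace integrals over the half-line -/

/-- The Laplace integral of a function on `ℝ`, over the half-line. -/
noncomputable def halfLap (f : ℝ → ℂ) (s : ℂ) : ℂ :=
  ∫ x in Ioi (0 : ℝ), f x * Complex.exp (-s * x)

lemma laplace_restrict (f : ℝ → ℂ) (s : ℂ) : laplace (restrict f) s = halfLap f s :=
  setIntegral_congr_fun measurableSet_Ioi fun x hx => by
    simp only [onReal_restrict f (le_of_lt hx)]

lemma IsSlow.hasDerivWithinAt {τ : ℝ≥0 → ℂ} (h : IsSlow τ) {x : ℝ} (hx : 0 ≤ x) :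
    HasDerivWithinAt (onReal τ) (hderiv τ x) (Ici 0) x :=
  (h.differentiableOn x hx).hasDerivWithinAt

lemma IsSlow.continuousOn_hderiv {τ : ℝ≥0 → ℂ} (h : IsSlow τ) : ContinuousOn (hderiv τ) (Ici 0) :=
  h.1.continuousOn_derivWithin (uniqueDiffOn_Ici 0) le_rfl

lemma norm_mul_exp_le {c : ℂ} {C b x : ℝ} (s : ℂ) (h : ‖c‖ ≤ C * Real.exp (-b * x)) :
    ‖c * Complex.exp (-s * x)‖ ≤ C * Real.exp (-(s.re + b) * x) := by
  rw [norm_mul, Complex.norm_exp]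
  have e : (-s * (x : ℂ)).re = -s.re * x := by simp
  rw [e]
  calc _ ≤ C * Real.exp (-b * x) * Real.exp (-s.re * x) := by gcongr
    _ = _ := by rw [mul_assoc, ← Real.exp_add]; congr 2; ring

lemma integrableOn_mul_exp {f : ℝ → ℂ} {C b : ℝ} (hf : ContinuousOn f (Ici 0))
    (hb : ∀ x, 0 ≤ x → ‖f x‖ ≤ C * Real.exp (-b * x)) {s : ℂ} (hs : -b < s.re) :
    IntegrableOn (fun x : ℝ => f x * Complex.exp (-s * x)) (Ioi 0) := by
  refine Integrable.mono' ((integrableOn_exp_mul_Ioi (a := -(s.re + b)) (by linarith) 0).const_mul C)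
    (((hf.mul (by fun_prop)).mono Ioi_subset_Ici_self).aestronglyMeasurable measurableSet_Ioi) ?_
  filter_upwards [ae_restrict_mem measurableSet_Ioi] with x hx
  exact norm_mul_exp_le s (hb x (le_of_lt hx))

lemma norm_halfLap_le {f : ℝ → ℂ} {C b : ℝ}
    (hb : ∀ x, 0 ≤ x → ‖f x‖ ≤ C * Real.exp (-b * x)) {s : ℂ} (hs : -b < s.re) :
    ‖halfLap f s‖ ≤ C / (s.re + b) := by
  have h := norm_integral_le_of_norm_le (μ := volume.restrict (Ioi 0))
    ((integrableOn_exp_mul_Ioi (a := -(s.re + b)) (by linarith) 0).const_mul C)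
    (f := fun x : ℝ => f x * Complex.exp (-s * x)) (by
      filter_upwards [ae_restrict_mem measurableSet_Ioi] with x hx
      exact norm_mul_exp_le s (hb x (le_of_lt hx)))
  rw [integral_const_mul, integral_exp_mul_Ioi (by linarith)] at h
  rwa [mul_zero, Real.exp_zero, neg_div_neg_eq, mul_one_div] at h

/-- Integration by parts. The norm contains no term for `τ 0`; this identity recovers it from the
derivative and the transform. -/
lemma IsSlow.mul_laplace {τ : ℝ≥0 → ℂ} (h : IsSlow τ) {s : ℂ} (hs : 0 < s.re) :
    s * laplace τ s = τ 0 + halfLap (hderiv τ) s := by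
  obtain ⟨M, hM⟩ := h.exists_bound
  have hi' := integrableOn_mul_exp (C := M) (b := 0) h.continuousOn_hderiv
    (by simpa using hM) (s := s) (by simpa using hs)
  have hi := h.integrableOn hs
  have hd : ∀ x ∈ Ioi (0 : ℝ), HasDerivAt (fun x : ℝ => onReal τ x * Complex.exp (-s * x))
      (hderiv τ x * Complex.exp (-s * x) - s * (onReal τ x * Complex.exp (-s * x))) x := by
    intro x hx
    have h1 := (h.hasDerivWithinAt (le_of_lt hx)).hasDerivAt (Ici_mem_nhds hx)
    have h2 : HasDerivAt (fun x : ℝ => Complex.exp (-s * x)) (Complex.exp (-s * x) * (-s * 1)) x :=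
      ((Complex.ofRealCLM.hasDerivAt (x := x)).const_mul (-s)).cexp
    refine (h1.mul h2).congr_deriv ?_
    ring
  have hc : ContinuousOn (fun x : ℝ => onReal τ x * Complex.exp (-s * x)) (Ici 0) :=
    h.1.continuousOn.mul (by fun_prop)
  have hi2 := hi'.sub (hi.const_mul s)
  -- The boundary term at infinity vanishes because the function and its derivative are both
  -- integrable, so no growth estimate is needed.
  have ht := tendsto_zero_of_hasDerivAt_of_integrableOn_Ioi hd hi2 hi
  have key := integral_Ioi_of_hasDerivAt_of_tendsto (hc 0 self_mem_Ici) hd hi2 ht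
  rw [integral_sub hi' (hi.const_mul s), integral_const_mul] at key
  have e0 : onReal τ 0 = τ 0 := by simp [onReal]
  simp only [Complex.ofReal_zero, mul_zero, Complex.exp_zero, mul_one, e0] at key
  unfold laplace halfLap
  linear_combination -key

lemma differentiableOn_halfLap {f : ℝ → ℂ} {C b : ℝ} (hf : ContinuousOn f (Ici 0))
    (hb : ∀ x, 0 ≤ x → ‖f x‖ ≤ C * Real.exp (-b * x)) :
    DifferentiableOn ℂ (halfLap f) {s | -b < s.re} := by
  intro s hs
  have hs : -b < s.re := hs
  -- Half the distance from `s` to the line `Re = -b`. One `d` pays for the factor `x` from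
  -- differentiation and `d / 2` for moving the parameter, which leaves the dominating function
  -- `e^{-(d/2)x}`.
  set d := (s.re + b) / 2 with hd
  have hd0 : 0 < d := by rw [hd]; linarith
  have hb1 : ∀ x, 0 ≤ x → ‖f x * x‖ ≤ (C / d) * Real.exp (-(b - d) * x) := by
    intro x hx
    have hC : 0 ≤ C := by
      have := (norm_nonneg _).trans (hb x hx)
      exact nonneg_of_mul_nonneg_left this (Real.exp_pos _)
    have h1 : x ≤ Real.exp (d * x) / d := by
      rw [le_div_iff₀ hd0]
      have := Real.add_one_le_exp (d * x)
      linarith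
    rw [norm_mul, Complex.norm_real, Real.norm_of_nonneg hx]
    calc _ ≤ C * Real.exp (-b * x) * (Real.exp (d * x) / d) := by
          gcongr; exact hb x hx
      _ = C / d * (Real.exp (-b * x) * Real.exp (d * x)) := by ring
      _ = _ := by rw [← Real.exp_add]; congr 2; ring
  have hopen : {w : ℂ | s.re - d / 2 < w.re} ∈ 𝓝 s :=
    (isOpen_lt continuous_const Complex.continuous_re).mem_nhds (by
      show s.re - d / 2 < s.re; linarith)
  have hfx : ContinuousOn (fun x : ℝ => f x * x) (Ici 0) := hf.mul (by fun_prop)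
  have key := hasDerivAt_integral_of_dominated_loc_of_deriv_le
    (μ := volume.restrict (Ioi (0 : ℝ))) (x₀ := s)
    (F := fun s (x : ℝ) => f x * Complex.exp (-s * x))
    (F' := fun s (x : ℝ) => -((f x * x) * Complex.exp (-s * x)))
    (bound := fun x => C / d * Real.exp (-(d / 2) * x)) hopen
    (Eventually.of_forall fun w => ((hf.mul (by fun_prop)).mono
      Ioi_subset_Ici_self).aestronglyMeasurable measurableSet_Ioi)
    (integrableOn_mul_exp hf hb hs)
    (((hfx.mul (by fun_prop)).mono Ioi_subset_Ici_self).aestronglyMeasurable measurableSet_Ioi).neg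
    ?_ ((integrableOn_exp_mul_Ioi (a := -(d / 2)) (by linarith) 0).const_mul _) ?_
  · exact key.2.differentiableAt.differentiableWithinAt
  · filter_upwards [ae_restrict_mem measurableSet_Ioi] with x hx w hw
    have hx : 0 < x := hx
    have hw : s.re - d / 2 < w.re := hw
    rw [norm_neg]
    refine (norm_mul_exp_le w (hb1 x hx.le)).trans ?_
    have hCd : 0 ≤ C / d := nonneg_of_mul_nonneg_left ((norm_nonneg _).trans (hb1 x hx.le))
      (Real.exp_pos _)
    gcongr
    rw [hd] at hw ⊢
    linarith
  · refine Eventually.of_forall fun x w _ => ?_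
    have h2 : HasDerivAt (fun w : ℂ => Complex.exp (-w * x)) (Complex.exp (-w * x) * (-1 * x)) w :=
      (((hasDerivAt_id w).neg).mul_const (x : ℂ)).cexp
    refine (h2.const_mul (f x)).congr_deriv ?_
    ring

/-! ### Exponentially decaying functions -/

/-- `f` is `C¹` on `[0, ∞)` with derivative `f'`, and both are `O(e^{-bx})` with constant `C`. -/
structure IsExpDecay (C b : ℝ) (f f' : ℝ → ℂ) : Prop where
  hasDeriv : ∀ x, 0 ≤ x → HasDerivWithinAt f (f' x) (Ici 0) x
  cont : ContinuousOn f' (Ici 0)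
  bound : ∀ x, 0 ≤ x → ‖f x‖ ≤ C * Real.exp (-b * x)
  bound' : ∀ x, 0 ≤ x → ‖f' x‖ ≤ C * Real.exp (-b * x)

namespace IsExpDecay

variable {C b : ℝ} {f f' : ℝ → ℂ}

lemma continuousOn (h : IsExpDecay C b f f') : ContinuousOn f (Ici 0) :=
  fun x hx => (h.hasDeriv x hx).continuousWithinAt

lemma isSlow (h : IsExpDecay C b f f') (hb : 0 < b) : IsSlow (restrict f) := by
  refine isSlow_restrict h.hasDeriv h.cont (squeeze_zero_norm' (a := fun x =>
    C * Real.exp (-b * x)) ?_ ?_)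
  · filter_upwards [eventually_ge_atTop 0] with x hx using h.bound' x hx
  · have : Tendsto (fun x => -b * x) atTop atBot :=
      tendsto_id.const_mul_atTop_of_neg (by linarith)
    simpa using (Real.tendsto_exp_atBot.comp this).const_mul C

lemma isHalfPlaneExt (h : IsExpDecay C b f f') :
    IsHalfPlaneExt ((-b : ℝ) : EReal) (restrict f) (halfLap f) := by
  refine ⟨(differentiableOn_halfLap h.continuousOn h.bound).mono fun s hs => ?_,
    fun s _ _ => (laplace_restrict f s).symm⟩
  exact EReal.coe_lt_coe_iff.1 hs

end IsExpDecay

/-- A function with derivative that decays faster than every exponential lies in `V_{-∞}`. -/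
lemma restrict_mem_halfPlaneSubmodule_bot {f f' : ℝ → ℂ}
    (h : ∀ b : ℝ, ∃ C, IsExpDecay C b f f') : restrict f ∈ halfPlaneSubmodule ⊥ := by
  obtain ⟨C, hC⟩ := h 1
  refine ⟨hC.isSlow one_pos, halfLap f, fun s _ => ?_, fun s _ _ => (laplace_restrict f s).symm⟩
  -- Differentiability is local and `halfLap f` does not depend on the rate, so each point `s` may
  -- use its own rate `b`, chosen so that `-b < Re s`.
  obtain ⟨C', hC'⟩ := h (1 - s.re)
  have h2 := differentiableOn_halfLap hC'.continuousOn hC'.bound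
  exact (h2.differentiableAt ((isOpen_lt continuous_const Complex.continuous_re).mem_nhds
    (by show -(1 - s.re) < s.re; linarith))).differentiableWithinAt

lemma continuous_hderiv_coe {τ : ℝ≥0 → ℂ} (h : IsSlow τ) :
    Continuous fun x : ℝ≥0 => hderiv τ x :=
  h.continuousOn_hderiv.comp_continuous NNReal.continuous_coe fun x => x.2

/-! ### The Banach space `V_{α,r}` -/

namespace VRect

variable {α r : ℝ} {hα : α < 0} {hr : 0 < r}

instance : CompactSpace (closure (rect α r)) :=
  isCompact_iff_compactSpace.1 (isCompact_closure_rect α r)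

/-- The element of `V_{α,r}` given by a function with the required properties. -/
def of (τ : ℝ≥0 → ℂ) (h : τ ∈ rectSubmodule α r) : VRect α r hα hr := ⟨τ, h⟩

lemma norm_def (τ : VRect α r hα hr) : ‖τ‖ = rectNorm α r τ.1 := rfl

lemma isRectExt (τ : VRect α r hα hr) : IsRectExt α r τ.1 (rectExt α r τ.1) :=
  τ.2.2.choose_spec.rectExt

lemma norm_hderiv_le (τ : VRect α r hα hr) {x : ℝ} (hx : 0 ≤ x) : ‖hderiv τ.1 x‖ ≤ ‖τ‖ := by
  have h1 := le_ciSup τ.2.1.bddAbove ⟨x, hx⟩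
  have h2 : 0 ≤ ⨆ s : closure (rect α r), ‖rectExt α r τ.1 s‖ :=
    Real.iSup_nonneg fun _ => norm_nonneg _
  rw [norm_def, rectNorm]
  exact h1.trans (by linarith)

lemma norm_rectExt_le (τ : VRect α r hα hr) {s : ℂ} (hs : s ∈ closure (rect α r)) :
    ‖rectExt α r τ.1 s‖ ≤ ‖τ‖ := by
  have h1 := le_ciSup (bddAbove_rectExt τ.2) ⟨s, hs⟩
  have h2 : 0 ≤ ⨆ x : ℝ≥0, ‖hderiv τ.1 x‖ := Real.iSup_nonneg fun _ => norm_nonneg _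
  rw [norm_def, rectNorm]
  exact h1.trans (by linarith)

/-- By uniqueness on the closed rectangle, any explicit continuation may replace the chosen
`rectExt` in norm estimates. -/
lemma norm_le {τ : VRect α r hα hr} {F : ℂ → ℂ} (hF : IsRectExt α r τ.1 F) {a b : ℝ}
    (ha : ∀ x, 0 ≤ x → ‖hderiv τ.1 x‖ ≤ a) (hb : ∀ s ∈ closure (rect α r), ‖F s‖ ≤ b) :
    ‖τ‖ ≤ a + b := by
  have ha0 : 0 ≤ a := (norm_nonneg _).trans (ha 0 le_rfl)
  refine add_le_add (ciSup_le fun x => ha x x.2) (Real.iSup_le (fun s => ?_) ?_)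
  · rw [hF.rectExt_eqOn s.2]; exact hb s s.2
  · have : (1 / 2 : ℂ) ∈ rect α r := by
      refine ⟨?_, ?_, ?_⟩ <;> norm_num <;> linarith
    exact (norm_nonneg _).trans (hb _ (subset_closure this))

/-- The derivative, as a continuous linear map to the bounded continuous functions. -/
noncomputable def derivL : VRect α r hα hr →L[ℂ] BoundedContinuousFunction ℝ≥0 ℂ :=
  LinearMap.mkContinuous
    { toFun := fun τ => BoundedContinuousFunction.ofNormedAddCommGroup
        (fun x : ℝ≥0 => hderiv τ.1 x) (continuous_hderiv_coe τ.2.1) ‖τ‖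
        fun x => norm_hderiv_le τ x.2
      map_add' := fun τ σ => by
        ext x; exact hderiv_add τ.2.1 σ.2.1 x.2
      map_smul' := fun c τ => by
        ext x; exact hderiv_smul c τ.2.1 x.2 } 1
    fun τ => by
      rw [one_mul]
      exact (BoundedContinuousFunction.norm_le (norm_nonneg _)).2 fun x => norm_hderiv_le τ x.2

@[simp] lemma derivL_apply (τ : VRect α r hα hr) (x : ℝ≥0) : derivL τ x = hderiv τ.1 x := rfl

/-- The continued Laplace transform, as a continuous linear map. -/
noncomputable def extL : VRect α r hα hr →L[ℂ] C(closure (rect α r), ℂ) :=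
  LinearMap.mkContinuous
    { toFun := fun τ => ⟨fun s => rectExt α r τ.1 s, τ.isRectExt.2.1.domRestrict⟩
      map_add' := fun τ σ => by
        ext s
        exact (IsRectExt.add τ.2.1 σ.2.1 τ.isRectExt σ.isRectExt).rectExt_eqOn s.2
      map_smul' := fun c τ => by
        ext s
        exact (τ.isRectExt.smul c).rectExt_eqOn s.2 } 1
    fun τ => by
      rw [one_mul]
      exact (ContinuousMap.norm_le _ (norm_nonneg _)).2 fun s => norm_rectExt_le τ s.2

@[simp] lemma extL_apply (τ : VRect α r hα hr) (s : closure (rect α r)) :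
    extL τ s = rectExt α r τ.1 s := rfl

/-- The pair `(derivL, extL)` thus embeds `V_{α,r}` isometrically into a product of two Banach
spaces with the sum norm, so completeness means that the image is closed. -/
lemma norm_eq (τ : VRect α r hα hr) : ‖τ‖ = ‖derivL τ‖ + ‖extL τ‖ := by
  rw [BoundedContinuousFunction.norm_eq_iSup_norm, ContinuousMap.norm_eq_iSup_norm]
  rfl

/-- The identity `s 𝓛τ(s) = τ(0) + 𝓛τ'(s)`, as a formula for `τ(0)`. -/
lemma mul_rectExt (τ : VRect α r hα hr) {s : ℂ} (hs : s ∈ rect α r) (h0 : 0 < s.re) :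
    s * rectExt α r τ.1 s = τ.1 0 + halfLap (hderiv τ.1) s := by
  rw [τ.isRectExt.2.2 s hs h0, τ.2.1.mul_laplace h0]

lemma half_mem_rect (hα : α < 0) (hr : 0 < r) : (1 / 2 : ℂ) ∈ rect α r := by
  refine ⟨?_, ?_, ?_⟩ <;> norm_num <;> linarith

/-- At `s = 1/2` the identity `mul_rectExt` gives `|τ(0)| ≤ ‖τ‖/2 + 2‖τ‖`. In the completeness proof
this yields the initial value of the limit. -/
lemma norm_apply_zero_le (τ : VRect α r hα hr) : ‖τ.1 0‖ ≤ 3 * ‖τ‖ := by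
  have h := mul_rectExt τ (half_mem_rect hα hr) (by norm_num)
  have h1 := norm_rectExt_le τ (subset_closure (half_mem_rect hα hr))
  have h2 := norm_halfLap_le (C := ‖τ‖) (b := 0) (f := hderiv τ.1) (s := 1 / 2)
    (fun x hx => by simpa using norm_hderiv_le τ hx) (by norm_num)
  have e : τ.1 0 = 1 / 2 * rectExt α r τ.1 (1 / 2) - halfLap (hderiv τ.1) (1 / 2) := by
    rw [h]; ring
  rw [e]
  refine (norm_sub_le _ _).trans ?_
  rw [norm_mul]
  norm_num at h2 ⊢
  norm_num at h1
  linarith [norm_nonneg τ]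

/-- An element of `V_{α,r}` with zero derivative is zero: a nonzero constant `c` has Laplace
transform `c / s`, which has a pole at `0`. -/
lemma derivL_injective : Function.Injective (derivL (α := α) (r := r) (hα := hα) (hr := hr)) := by
  rw [injective_iff_map_eq_zero]
  intro τ hτ
  have hd : ∀ x : ℝ, 0 ≤ x → hderiv τ.1 x = 0 := fun x hx => DFunLike.congr_fun hτ ⟨x, hx⟩
  have hl : ∀ s, halfLap (hderiv τ.1) s = 0 := fun s =>
    (setIntegral_congr_fun measurableSet_Ioi (g := fun _ => (0 : ℂ)) fun x hx => by
      simp [hd x (le_of_lt hx)]).trans (by simp)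
  -- The identity `s 𝓛τ(s) = τ(0)` continues from `Re s > 0` to the whole rectangle, which contains
  -- `s = 0` because `α < 0`; there it reads `0 = τ(0)`.
  have key : EqOn (fun s => s * rectExt α r τ.1 s) (fun _ => τ.1 0) (rect α r) := by
    refine AnalyticOnNhd.eqOn_of_preconnected_of_eventuallyEq
      ((differentiableOn_id.mul τ.isRectExt.1).analyticOnNhd (isOpen_rect α r))
      analyticOnNhd_const (convex_rect α r).isPreconnected (half_mem_rect hα hr) ?_
    have ho : IsOpen (rect α r ∩ {w : ℂ | 0 < w.re}) :=
      (isOpen_rect α r).inter (isOpen_lt continuous_const Complex.continuous_re)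
    filter_upwards [ho.mem_nhds ⟨half_mem_rect hα hr, by norm_num⟩] with w hw
    rw [mul_rectExt τ hw.1 hw.2, hl, add_zero]
  have h0 : τ.1 0 = 0 := by
    have := key (x := 0) (by refine ⟨?_, ?_, ?_⟩ <;> simp [hα, hr])
    simpa using this.symm
  refine Subtype.ext (funext fun x => ?_)
  have := Convex.norm_image_sub_le_of_norm_hasDerivWithin_le (C := 0)
    (fun y hy => τ.2.1.hasDerivWithinAt hy)
    (fun y hy => by rw [hd y hy, norm_zero]) (convex_Ici (0 : ℝ)) (mem_Ici.2 le_rfl)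
    (mem_Ici.2 x.2)
  rw [zero_mul, norm_le_zero_iff, sub_eq_zero] at this
  have h : τ.1 x = 0 := by simpa [onReal, h0] using this
  exact h

/-- `V_{α,r}` is a Banach space. -/
instance : CompleteSpace (VRect α r hα hr) := by
  refine Metric.complete_of_cauchySeq_tendsto fun τ hτ => ?_
  obtain ⟨u, hu⟩ := cauchySeq_tendsto_of_complete (derivL.uniformContinuous.comp_cauchySeq hτ)
  obtain ⟨G, hG⟩ := cauchySeq_tendsto_of_complete (extL.uniformContinuous.comp_cauchySeq hτ)
  obtain ⟨c, hc⟩ : ∃ c, Tendsto (fun n => (τ n).1 0) atTop (𝓝 c) := by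
    refine cauchySeq_tendsto_of_complete (Metric.cauchySeq_iff.2 fun ε hε => ?_)
    obtain ⟨N, hN⟩ := Metric.cauchySeq_iff.1 hτ (ε / 3) (by positivity)
    refine ⟨N, fun m hm n hn => ?_⟩
    have h1 := hN m hm n hn
    rw [dist_eq_norm] at h1 ⊢
    have h2 := norm_apply_zero_le (τ m - τ n)
    have h3 : (τ m - τ n).1 0 = (τ m).1 0 - (τ n).1 0 := rfl
    rw [h3] at h2
    linarith
  have hu' : ∀ x : ℝ≥0, Tendsto (fun n => hderiv (τ n).1 x) atTop (𝓝 (u x)) := fun x =>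
    ((BoundedContinuousFunction.evalCLM ℂ x).continuous.tendsto _).comp hu
  have hG' : ∀ s : closure (rect α r), Tendsto (fun n => rectExt α r (τ n).1 s) atTop (𝓝 (G s)) := fun s =>
    ((ContinuousMap.evalCLM ℂ s).continuous.tendsto _).comp hG
  set u1 : ℝ → ℂ := fun x => u x.toNNReal with hu1
  have hu1c : Continuous u1 := u.continuous.comp continuous_real_toNNReal
  -- The limit function is rebuilt from the limit `c` of the initial values and the uniform limit
  -- `u` of the derivatives.
  set f : ℝ → ℂ := fun x => c + ∫ t in (0 : ℝ)..x, u1 t with hf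
  have hfd : ∀ x, HasDerivAt f (u1 x) x := fun x =>
    (intervalIntegral.integral_hasDerivAt_right (hu1c.intervalIntegrable _ _)
      (hu1c.stronglyMeasurableAtFilter _ _) hu1c.continuousAt).const_add c
  have hfd' : ∀ x : ℝ, 0 ≤ x → hderiv (restrict f) x = u1 x := fun x hx =>
    hderiv_restrict hx (hfd x).hasDerivWithinAt
  have hunif : ∀ ε > 0, ∀ᶠ n in atTop, ∀ x : ℝ, 0 ≤ x → ‖hderiv (τ n).1 x - u1 x‖ ≤ ε := by
    intro ε hε
    filter_upwards [(tendsto_iff_norm_sub_tendsto_zero.1 hu).eventually_le_const hε] with n hn x hx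
    have := (derivL (τ n) - u).norm_coe_le_norm x.toNNReal
    have e : ((x.toNNReal : ℝ≥0) : ℝ) = x := Real.coe_toNNReal x hx
    simp only [BoundedContinuousFunction.coe_sub, Pi.sub_apply, derivL_apply, e] at this
    exact this.trans hn
  have hslow : IsSlow (restrict f) := by
    refine isSlow_restrict (fun x _ => (hfd x).hasDerivWithinAt) hu1c.continuousOn ?_
    rw [Metric.tendsto_nhds]
    intro ε hε
    obtain ⟨n, hn⟩ := (hunif (ε / 2) (by positivity)).exists
    filter_upwards [Metric.tendsto_nhds.1 (τ n).2.1.2 (ε / 2) (by positivity),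
      eventually_ge_atTop 0] with x hx hx0
    rw [dist_zero_right] at hx ⊢
    have h1 := hn x hx0
    have h2 := norm_sub_norm_le (u1 x) (hderiv (τ n).1 x)
    rw [norm_sub_rev] at h2
    linarith
  classical
  set G1 : ℂ → ℂ := fun s => if hs : s ∈ closure (rect α r) then G ⟨s, hs⟩ else 0 with hG1
  have hG1s : ∀ s (hs : s ∈ closure (rect α r)), G1 s = G ⟨s, hs⟩ := fun s hs => dif_pos hs
  have hGunif : TendstoUniformlyOn (fun n s => rectExt α r (τ n).1 s) G1 atTop
      (closure (rect α r)) := by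
    rw [Metric.tendstoUniformlyOn_iff]
    intro ε hε
    filter_upwards [Metric.tendsto_nhds.1 hG ε hε] with n hn s hs
    rw [hG1s s hs, dist_comm]
    exact (ContinuousMap.dist_apply_le_dist (f := extL (τ n)) (g := G) ⟨s, hs⟩).trans_lt hn
  have hext : IsRectExt α r (restrict f) G1 := by
    refine ⟨?_, ?_, fun s hs h0 => ?_⟩
    · exact (hGunif.mono subset_closure).tendstoLocallyUniformlyOn.differentiableOn
        (Eventually.of_forall fun n => (τ n).isRectExt.1) (isOpen_rect α r)
    · exact hGunif.continuousOn (Frequently.of_forall fun n => (τ n).isRectExt.2.1)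
    -- The limit is taken in `s 𝓛τ(s) = τ(0) + 𝓛τ'(s)` rather than in `𝓛τ(s)` itself, because it is
    -- the derivatives that converge uniformly on the half-line.
    · have hs0 : s ≠ 0 := by rintro rfl; simp at h0
      have h1 : Tendsto (fun n => s * rectExt α r (τ n).1 s) atTop (𝓝 (s * G1 s)) := by
        rw [hG1s s (subset_closure hs)]
        exact (hG' ⟨s, subset_closure hs⟩).const_mul s
      have hlap : Tendsto (fun n => halfLap (hderiv (τ n).1) s) atTop
          (𝓝 (halfLap (hderiv (restrict f)) s)) := by
        rw [tendsto_iff_norm_sub_tendsto_zero]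
        refine squeeze_zero' (Eventually.of_forall fun _ => norm_nonneg _)
          (Eventually.of_forall fun n => ?_)
          (g := fun n => ‖derivL (τ n) - u‖ / (s.re + 0)) ?_
        · have hI : ∀ {σ : ℝ≥0 → ℂ}, IsSlow σ → IntegrableOn
              (fun x : ℝ => hderiv σ x * Complex.exp (-s * x)) (Ioi 0) := by
            intro σ hσ
            obtain ⟨M, hM⟩ := hσ.exists_bound
            exact integrableOn_mul_exp (C := M) (b := 0) hσ.continuousOn_hderiv
              (by simpa using hM) (by simpa using h0)
          have e : halfLap (hderiv (τ n).1) s - halfLap (hderiv (restrict f)) s =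
              halfLap (fun x => hderiv (τ n).1 x - hderiv (restrict f) x) s := by
            unfold halfLap
            rw [← integral_sub (hI (τ n).2.1) (hI hslow)]
            simp only [sub_mul]
          rw [e]
          refine norm_halfLap_le (fun x hx => ?_) (by simpa using h0)
          rw [hfd' x hx]
          have := (derivL (τ n) - u).norm_coe_le_norm x.toNNReal
          have e : ((x.toNNReal : ℝ≥0) : ℝ) = x := Real.coe_toNNReal x hx
          simp only [BoundedContinuousFunction.coe_sub, Pi.sub_apply, derivL_apply, e] at this
          simpa using this
        · simpa using (tendsto_iff_norm_sub_tendsto_zero.1 hu).div_const (s.re + 0)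
      have h2 : Tendsto (fun n => s * rectExt α r (τ n).1 s) atTop
          (𝓝 (c + halfLap (hderiv (restrict f)) s)) :=
        (hc.add hlap).congr fun n => (mul_rectExt (τ n) hs h0).symm
      have h3 := hslow.mul_laplace h0
      have h4 : restrict f 0 = c := by simp [restrict, hf]
      rw [h4, ← tendsto_nhds_unique h1 h2] at h3
      exact (mul_left_cancel₀ hs0 h3).symm
  refine ⟨⟨restrict f, hslow, G1, hext⟩, ?_⟩
  set σ : VRect α r hα hr := ⟨restrict f, hslow, G1, hext⟩ with hσ
  have hd : derivL σ = u := by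
    ext x
    exact (hfd' x x.2).trans (by simp [hu1])
  have he : extL σ = G := by
    ext s
    exact (hext.rectExt_eqOn s.2).trans (hG1s s s.2)
  rw [tendsto_iff_norm_sub_tendsto_zero]
  have h := (tendsto_iff_norm_sub_tendsto_zero.1 hu).add (tendsto_iff_norm_sub_tendsto_zero.1 hG)
  rw [add_zero] at h
  refine h.congr fun n => ?_
  rw [norm_eq, map_sub, map_sub, hd, he]
  rfl

end VRect

lemma IsRectExt.sub {α r : ℝ} {τ σ : ℝ≥0 → ℂ} {F G : ℂ → ℂ} (h : IsSlow τ) (h' : IsSlow σ)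
    (hF : IsRectExt α r τ F) (hG : IsRectExt α r σ G) :
    IsRectExt α r (τ - σ) (fun s => F s - G s) := by
  have := hF.add h (h'.smul (-1)) (hG.smul (-1))
  rw [neg_one_smul, neg_one_smul, ← sub_eq_add_neg, ← sub_eq_add_neg] at this
  exact this

lemma le_re_of_mem_closure_rect {α r : ℝ} {s : ℂ} (hs : s ∈ closure (rect α r)) : α ≤ s.re :=
  closure_minimal (t := {s : ℂ | α ≤ s.re}) (fun _ h => h.1.le)
    (isClosed_le continuous_const Complex.continuous_re) hs

/-- The bound `C / (Re s + b)` for the transform is largest on the left edge `Re s = α`. -/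
lemma norm_le_of_isExpDecay {α r : ℝ} {hα : α < 0} {hr : 0 < r} {τ : VRect α r hα hr} {C b : ℝ}
    {f f' : ℝ → ℂ} (h : IsExpDecay C b f f') (hτ : τ.1 = restrict f) (hb : -b < α) :
    ‖τ‖ ≤ C + C / (α + b) := by
  have hF := h.isHalfPlaneExt.isRectExt (EReal.coe_lt_coe_iff.2 hb) r
  rw [← hτ] at hF
  have hC : 0 ≤ C := nonneg_of_mul_nonneg_left ((norm_nonneg _).trans (h.bound 0 le_rfl))
    (Real.exp_pos _)
  refine VRect.norm_le hF (fun x hx => ?_) fun s hs => ?_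
  · rw [hτ, hderiv_restrict hx (h.hasDeriv x hx)]
    refine (h.bound' x hx).trans (mul_le_of_le_one_right hC (Real.exp_le_one_iff.2 ?_))
    nlinarith
  · have := le_re_of_mem_closure_rect hs
    refine (norm_halfLap_le h.bound (by linarith)).trans ?_
    gcongr
    linarith

/-! Exponentials -/

/-- The function `(A + Bx) e^{zx - εx²}`. -/
noncomputable def gaussExp (A B z : ℂ) (ε : ℝ) (x : ℝ) : ℂ :=
  (A + B * x) * Complex.exp (z * x - ε * x ^ 2)

/-- The derivative of `gaussExp`. -/
noncomputable def gaussExpDeriv (A B z : ℂ) (ε : ℝ) (x : ℝ) : ℂ :=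
  (B + (A + B * x) * (z - 2 * ε * x)) * Complex.exp (z * x - ε * x ^ 2)

lemma hasDerivAt_gaussExp (A B z : ℂ) (ε x : ℝ) :
    HasDerivAt (gaussExp A B z ε) (gaussExpDeriv A B z ε x) x := by
  have h0 : HasDerivAt (fun x : ℝ => (x : ℂ)) 1 x := Complex.ofRealCLM.hasDerivAt
  have h1 : HasDerivAt (fun x : ℝ => A + B * (x : ℂ)) (B * 1) x := (h0.const_mul B).const_add A
  have h2 : HasDerivAt (fun x : ℝ => z * (x : ℂ) - ε * (x : ℂ) ^ 2)
      (z * 1 - ε * ((2 : ℕ) * (x : ℂ) ^ (2 - 1) * 1)) x :=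
    (h0.const_mul z).sub ((h0.pow 2).const_mul (ε : ℂ))
  refine (h1.mul h2.cexp).congr_deriv ?_
  unfold gaussExpDeriv
  push_cast
  ring

lemma continuous_gaussExpDeriv (A B z : ℂ) (ε : ℝ) : Continuous (gaussExpDeriv A B z ε) := by
  unfold gaussExpDeriv; fun_prop

lemma norm_cexp_quadratic (z : ℂ) (ε x : ℝ) :
    ‖Complex.exp (z * x - ε * x ^ 2)‖ = Real.exp (z.re * x - ε * x ^ 2) := by
  rw [Complex.norm_exp]
  congr 1
  have : (ε : ℂ) * (x : ℂ) ^ 2 = ((ε * x ^ 2 : ℝ) : ℂ) := by push_cast; ring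
  rw [this, Complex.sub_re, Complex.ofReal_re, Complex.re_mul_ofReal]

/-- The Gaussian beats every exponential: polynomial factors are absorbed by `(1 + x)² ≤ e^{2x}`,
and completing the square bounds `(Re z + 2 + b) x - ε x²` for any rate `b`. -/
lemma gaussExp_mem (A B z : ℂ) {ε : ℝ} (hε : 0 < ε) :
    restrict (gaussExp A B z ε) ∈ halfPlaneSubmodule ⊥ := by
  refine restrict_mem_halfPlaneSubmodule_bot (f' := gaussExpDeriv A B z ε) fun b => ?_
  set K := ‖B‖ + (‖A‖ + ‖B‖) * (‖z‖ + 2 * ε + 1) with hK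
  have hexp : ∀ x : ℝ, 0 ≤ x → (1 + x) ^ 2 * Real.exp (z.re * x - ε * x ^ 2) ≤
      Real.exp ((z.re + 2 + b) ^ 2 / (4 * ε)) * Real.exp (-b * x) := by
    intro x hx
    have h1 : (1 + x) ^ 2 ≤ Real.exp (2 * x) := by
      rw [two_mul, Real.exp_add, ← sq]
      have := Real.add_one_le_exp x
      gcongr
      linarith
    refine (mul_le_mul_of_nonneg_right h1 (Real.exp_pos _).le).trans ?_
    rw [← Real.exp_add, ← Real.exp_add, Real.exp_le_exp]
    have h2 : (z.re + 2 + b) ^ 2 / (4 * ε) - (z.re + 2 + b) * x + ε * x ^ 2 =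
        ε * (x - (z.re + 2 + b) / (2 * ε)) ^ 2 := by field_simp; ring
    have h3 : 0 ≤ ε * (x - (z.re + 2 + b) / (2 * ε)) ^ 2 := by positivity
    linarith
  have hlin : ∀ x : ℝ, 0 ≤ x → ‖A + B * x‖ ≤ (‖A‖ + ‖B‖) * (1 + x) := by
    intro x hx
    refine (norm_add_le _ _).trans ?_
    rw [norm_mul, Complex.norm_real, Real.norm_of_nonneg hx]
    nlinarith [norm_nonneg A, norm_nonneg B, mul_nonneg (norm_nonneg A) hx]
  refine ⟨K * Real.exp ((z.re + 2 + b) ^ 2 / (4 * ε)),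
    fun x _ => (hasDerivAt_gaussExp A B z ε x).hasDerivWithinAt,
    (continuous_gaussExpDeriv A B z ε).continuousOn, fun x hx => ?_, fun x hx => ?_⟩
  · rw [gaussExp, norm_mul, norm_cexp_quadratic, mul_assoc K]
    refine le_trans ?_ (mul_le_mul_of_nonneg_left (hexp x hx) (by positivity))
    rw [← mul_assoc]
    gcongr
    refine (hlin x hx).trans ?_
    rw [hK]
    nlinarith [norm_nonneg A, norm_nonneg B, norm_nonneg z, mul_nonneg (norm_nonneg A) hx,
      mul_nonneg (norm_nonneg B) hx, mul_nonneg (add_nonneg (norm_nonneg A) (norm_nonneg B))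
        (add_nonneg (norm_nonneg z) (mul_nonneg zero_le_two hε.le)), sq_nonneg (1 + x),
      mul_nonneg (mul_nonneg (add_nonneg (norm_nonneg A) (norm_nonneg B))
        (add_nonneg (norm_nonneg z) (mul_nonneg zero_le_two hε.le))) (sq_nonneg (1 + x)),
      mul_nonneg (add_nonneg (norm_nonneg A) (norm_nonneg B)) (sq_nonneg x)]
  · rw [gaussExpDeriv, norm_mul, norm_cexp_quadratic, mul_assoc K]
    refine le_trans ?_ (mul_le_mul_of_nonneg_left (hexp x hx) (by positivity))
    rw [← mul_assoc]
    gcongr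
    have h1 : ‖z - 2 * ε * x‖ ≤ (‖z‖ + 2 * ε) * (1 + x) := by
      refine (norm_sub_le _ _).trans ?_
      have : ‖(2 : ℂ) * ε * x‖ = 2 * ε * x := by
        rw [norm_mul, norm_mul, Complex.norm_real, Complex.norm_real, Real.norm_of_nonneg hx,
          Real.norm_of_nonneg hε.le]
        norm_num
      rw [this]
      nlinarith [norm_nonneg z, mul_nonneg (norm_nonneg z) hx]
    calc _ ≤ ‖B‖ + (‖A‖ + ‖B‖) * (1 + x) * ((‖z‖ + 2 * ε) * (1 + x)) := by
          refine (norm_add_le _ _).trans ?_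
          rw [norm_mul]
          gcongr
          exact hlin x hx
      _ ≤ ‖B‖ * (1 + x) ^ 2 + (‖A‖ + ‖B‖) * (‖z‖ + 2 * ε + 1) * (1 + x) ^ 2 := by
          have h5 : ‖B‖ * 1 ≤ ‖B‖ * (1 + x) ^ 2 := by gcongr; nlinarith
          have h6 : 0 ≤ (‖A‖ + ‖B‖) * (1 + x) ^ 2 := by positivity
          nlinarith
      _ = _ := by rw [hK]; ring

/-- `x^n e^{-ax} ≤ n! / a^n`. -/
lemma pow_mul_exp_le (n : ℕ) {a x : ℝ} (ha : 0 < a) (hx : 0 ≤ x) :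
    x ^ n * Real.exp (-a * x) ≤ n.factorial / a ^ n := by
  have h := Real.pow_div_factorial_le_exp (a * x) (by positivity) n
  have hf : (0 : ℝ) < n.factorial := by exact_mod_cast n.factorial_pos
  rw [div_le_iff₀ hf, mul_pow] at h
  rw [le_div_iff₀ (by positivity)]
  calc x ^ n * Real.exp (-a * x) * a ^ n = (a ^ n * x ^ n) * Real.exp (-a * x) := by ring
    _ ≤ (Real.exp (a * x) * n.factorial) * Real.exp (-a * x) := by gcongr
    _ = n.factorial * (Real.exp (a * x) * Real.exp (-a * x)) := by ring
    _ = n.factorial := by rw [← Real.exp_add]; simp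

section exponential

variable {α r : ℝ}

lemma isSlow_gaussExp_zero (A B : ℂ) {z : ℂ} (hz : z.re < 0) :
    IsSlow (restrict (gaussExp A B z 0)) := by
  refine isSlow_restrict (fun x _ => (hasDerivAt_gaussExp A B z 0 x).hasDerivWithinAt)
    (continuous_gaussExpDeriv A B z 0).continuousOn ?_
  have h0 : Tendsto (fun x : ℝ => Real.exp (z.re * x)) atTop (𝓝 0) :=
    Real.tendsto_exp_atBot.comp (tendsto_id.const_mul_atTop_of_neg hz)
  have h1 : Tendsto (fun x : ℝ => x * Real.exp (z.re * x)) atTop (𝓝 0) := by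
    have := Real.tendsto_pow_mul_exp_neg_atTop_nhds_zero 1
    have h2 := (this.comp (tendsto_id.const_mul_atTop (neg_pos.2 hz))).const_mul (-z.re)⁻¹
    rw [mul_zero] at h2
    refine h2.congr fun x => ?_
    have : z.re ≠ 0 := hz.ne
    simp only [Function.comp, id, pow_one, neg_mul, neg_neg]
    field_simp
  refine squeeze_zero_norm (a := fun x => ‖B + A * z‖ * Real.exp (z.re * x) +
    ‖B * z‖ * |x * Real.exp (z.re * x)|) (fun x => ?_) (by
      simpa using (h0.const_mul ‖B + A * z‖).add (h1.abs.const_mul ‖B * z‖))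
  rw [gaussExpDeriv, norm_mul, norm_cexp_quadratic]
  have e : B + (A + B * x) * (z - 2 * (0 : ℝ) * x) = (B + A * z) + (B * z) * x := by
    push_cast; ring
  rw [e]
  calc _ ≤ (‖B + A * z‖ + ‖B * z‖ * |x|) * Real.exp (z.re * x - 0 * x ^ 2) := by
        gcongr
        refine (norm_add_le _ _).trans ?_
        rw [norm_mul (B * z), Complex.norm_real, Real.norm_eq_abs]
    _ = _ := by rw [abs_mul, abs_of_pos (Real.exp_pos _)]; ring_nf

/-- The open set of exponents `z` for which `e^{zx}` is an element of `V_{α,r}`. -/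
def expDomain (α r : ℝ) : Set ℂ := {z | z.re < 0 ∧ z ∉ closure (rect α r)}

lemma isOpen_expDomain (α r : ℝ) : IsOpen (expDomain α r) :=
  (isOpen_lt Complex.continuous_re continuous_const).inter isClosed_closure.isOpen_compl

lemma sub_ne_zero_of_mem_expDomain {z s : ℂ} (hz : z ∈ expDomain α r)
    (hs : s ∈ closure (rect α r)) : s - z ≠ 0 := fun h => by
  rw [sub_eq_zero] at h
  exact hz.2 (h ▸ hs)

lemma isRectExt_exp {z : ℂ} (hz : z ∈ expDomain α r) :
    IsRectExt α r (restrict (gaussExp 1 0 z 0)) (fun s => (s - z)⁻¹) := by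
  have hne := fun s (hs : s ∈ closure (rect α r)) => sub_ne_zero_of_mem_expDomain hz hs
  refine ⟨fun s hs => ?_, fun s hs => ?_, fun s hs h0 => ?_⟩
  · exact ((differentiableAt_id.sub_const z).inv
      (hne s (subset_closure hs))).differentiableWithinAt
  · exact ((continuousAt_id.sub continuousAt_const).inv₀ (hne s hs)).continuousWithinAt
  · have hre : (z - s).re < 0 := by have := hz.1; simp only [Complex.sub_re]; linarith
    have e : ∀ x : ℝ, gaussExp 1 0 z 0 x * Complex.exp (-s * x) = Complex.exp ((z - s) * x) := by
      intro x
      rw [gaussExp, mul_assoc, ← Complex.exp_add]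
      simp only [zero_mul, add_zero, one_mul, Complex.ofReal_zero]
      congr 1
      ring
    rw [laplace_restrict, halfLap]
    simp only [e]
    rw [integral_exp_mul_complex_Ioi hre, Complex.ofReal_zero, mul_zero, Complex.exp_zero,
      ← neg_sub s z, neg_div_neg_eq, one_div]

/-- Since `(x e^{zx})' = e^{zx} + z x e^{zx}` and `x e^{zx}` vanishes at `0`, the identity
`IsSlow.mul_laplace` becomes `(s - z) 𝓛 = 1 / (s - z)`. -/
lemma isRectExt_mul_exp {z : ℂ} (hz : z ∈ expDomain α r) :
    IsRectExt α r (restrict (gaussExp 0 1 z 0)) (fun s => ((s - z) ^ 2)⁻¹) := by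
  have hne := fun s (hs : s ∈ closure (rect α r)) => sub_ne_zero_of_mem_expDomain hz hs
  refine ⟨fun s hs => ?_, fun s hs => ?_, fun s hs h0 => ?_⟩
  · exact (((differentiableAt_id.sub_const z).pow 2).inv
      (pow_ne_zero 2 (hne s (subset_closure hs)))).differentiableWithinAt
  · exact (((continuousAt_id.sub continuousAt_const).pow 2).inv₀
      (pow_ne_zero 2 (hne s hs))).continuousWithinAt
  · have h1 := (isSlow_gaussExp_zero 0 1 hz.1).mul_laplace h0
    have h2 := (isRectExt_exp hz).2.2 s hs h0
    have h3 : halfLap (hderiv (restrict (gaussExp 0 1 z 0))) s =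
        laplace (restrict (gaussExp 1 0 z 0) + z • restrict (gaussExp 0 1 z 0)) s := by
      refine setIntegral_congr_fun measurableSet_Ioi fun x hx => ?_
      have hx : (0 : ℝ) ≤ x := le_of_lt hx
      congr 1
      rw [hderiv_restrict hx (hasDerivAt_gaussExp 0 1 z 0 x).hasDerivWithinAt, restrict_smul]
      change _ = onReal (restrict (gaussExp 1 0 z 0 + z • gaussExp 0 1 z 0)) x
      rw [onReal_restrict _ hx]
      simp only [gaussExpDeriv, gaussExp, Pi.add_apply, Pi.smul_apply, smul_eq_mul]
      push_cast
      ring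
    rw [h3, laplace_add (isSlow_gaussExp_zero 1 0 hz.1) ((isSlow_gaussExp_zero 0 1 hz.1).smul z) h0,
      laplace_smul, ← h2] at h1
    have h4 : restrict (gaussExp 0 1 z 0) 0 = 0 := by simp [restrict, gaussExp]
    rw [h4, zero_add] at h1
    have hsz := hne s (subset_closure hs)
    have h5 : (s - z) * laplace (restrict (gaussExp 0 1 z 0)) s = (s - z)⁻¹ := by
      linear_combination h1
    refine inv_eq_of_mul_eq_one_right ?_
    calc _ = (s - z) * ((s - z) * laplace (restrict (gaussExp 0 1 z 0)) s) := by ring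
      _ = 1 := by rw [h5, mul_inv_cancel₀ hsz]

open Classical in
/-- The exponential `x ↦ e^{zx}` as an element of `V_{α,r}`. -/
noncomputable def expo (hα : α < 0) (hr : 0 < r) (z : ℂ) : VRect α r hα hr :=
  if h : z ∈ expDomain α r then
    VRect.of (restrict (gaussExp 1 0 z 0)) ⟨isSlow_gaussExp_zero 1 0 h.1, _, isRectExt_exp h⟩
  else 0

variable (hα : α < 0) (hr : 0 < r)

lemma expo_val {z : ℂ} (hz : z ∈ expDomain α r) :
    (expo hα hr z).1 = restrict (gaussExp 1 0 z 0) := by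
  rw [expo, dif_pos hz]
  rfl

lemma exists_le_norm_sub {z : ℂ} (hz : z ∈ expDomain α r) :
    ∃ d > 0, ∀ s ∈ closure (rect α r), d ≤ ‖s - z‖ := by
  obtain ⟨d, hd, h⟩ := Metric.isOpen_iff.1 isClosed_closure.isOpen_compl z hz.2
  refine ⟨d, hd, fun s hs => ?_⟩
  by_contra hlt
  exact h (by rw [Metric.mem_ball, dist_eq_norm]; linarith) hs

lemma norm_expo_le {z : ℂ} (hz : z ∈ expDomain α r) {d : ℝ} (hd : 0 < d)
    (h : ∀ s ∈ closure (rect α r), d ≤ ‖s - z‖) : ‖expo hα hr z‖ ≤ ‖z‖ + d⁻¹ := by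
  have hF := isRectExt_exp hz
  rw [← expo_val hα hr hz] at hF
  refine VRect.norm_le hF (fun x hx => ?_) fun s hs => ?_
  · rw [expo_val hα hr hz, hderiv_restrict hx (hasDerivAt_gaussExp 1 0 z 0 x).hasDerivWithinAt,
      gaussExpDeriv, norm_mul, norm_cexp_quadratic]
    have e : (0 : ℂ) + (1 + 0 * x) * (z - 2 * (0 : ℝ) * x) = z := by push_cast; ring
    rw [e]
    refine mul_le_of_le_one_right (norm_nonneg _) (Real.exp_le_one_iff.2 ?_)
    nlinarith [hz.1]
  · rw [norm_inv]
    exact inv_anti₀ hd (h s hs)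

/-- Complex differentiability in norm, with derivative `x e^{zx}`. Both the derivative part and the
transform part of the remainder are of second order in `w - z`. -/
lemma hasDerivAt_expo {z : ℂ} (hz : z ∈ expDomain α r) :
    HasDerivAt (expo hα hr) (VRect.of (restrict (gaussExp 0 1 z 0))
      ⟨isSlow_gaussExp_zero 0 1 hz.1, _, isRectExt_mul_exp hz⟩) z := by
  set e' : VRect α r hα hr := VRect.of (restrict (gaussExp 0 1 z 0))
    ⟨isSlow_gaussExp_zero 0 1 hz.1, _, isRectExt_mul_exp hz⟩ with he'
  obtain ⟨d, hd, hdist⟩ := exists_le_norm_sub hz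
  -- Here `|e^{zx}| = e^{-2ax}`. For `|w - z| < a` the Taylor remainders of `e^{(w-z)x}` cost a
  -- factor `e^{ax}`, and the remaining `e^{-ax}` absorbs the powers of `x`.
  set a := -z.re / 2 with ha
  have ha0 : 0 < a := by have := hz.1; rw [ha]; linarith
  set C := (‖z‖ * (2 / a ^ 2) + 1 / a) + 2 / d ^ 3 with hC
  have key : ∀ᶠ w in 𝓝 z, ‖expo hα hr w - expo hα hr z - (w - z) • e'‖ ≤ C * ‖(w - z) ^ 2‖ := by
    filter_upwards [(isOpen_expDomain α r).mem_nhds hz, Metric.ball_mem_nhds z ha0,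
      Metric.ball_mem_nhds z (half_pos hd)] with w hw hwa hwd
    rw [Metric.mem_ball, dist_eq_norm] at hwa hwd
    set h := w - z with hh
    have hwz : w = z + h := by rw [hh]; ring
    set τ := expo hα hr w - expo hα hr z - h • e' with hτ
    have hval : τ.1 = restrict (gaussExp 1 0 w 0 - gaussExp 1 0 z 0 - h • gaussExp 0 1 z 0) := by
      have : τ.1 = (expo hα hr w).1 - (expo hα hr z).1 - h • e'.1 := rfl
      rw [this, expo_val hα hr hw, expo_val hα hr hz]
      rfl
    have s1 := isSlow_gaussExp_zero 1 0 hw.1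
    have s2 := isSlow_gaussExp_zero 1 0 hz.1
    have s3 := isSlow_gaussExp_zero 0 1 hz.1
    have hF : IsRectExt α r τ.1 (fun s => (s - w)⁻¹ - (s - z)⁻¹ - h * ((s - z) ^ 2)⁻¹) := by
      rw [hval]
      have s12 : IsSlow (restrict (gaussExp 1 0 w 0) - restrict (gaussExp 1 0 z 0)) := by
        have := s1.add (s2.smul (-1))
        rwa [neg_one_smul, ← sub_eq_add_neg] at this
      exact ((isRectExt_exp hw).sub s1 s2 (isRectExt_exp hz)).sub s12 (s3.smul h)
        ((isRectExt_mul_exp hz).smul h)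
    rw [norm_pow, hC, add_mul]
    refine VRect.norm_le hF (fun x hx => ?_) fun s hs => ?_
    · have hd1 := ((hasDerivAt_gaussExp 1 0 w 0 x).sub (hasDerivAt_gaussExp 1 0 z 0 x)).sub
        ((hasDerivAt_gaussExp 0 1 z 0 x).const_smul h)
      rw [hval, hderiv_restrict hx hd1.hasDerivWithinAt]
      set A := Complex.exp (h * x) - 1 - h * x with hA
      set B := Complex.exp (h * x) - 1 with hB
      have e1 : gaussExpDeriv 1 0 w 0 x - gaussExpDeriv 1 0 z 0 x - h • gaussExpDeriv 0 1 z 0 x =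
          (z * A + h * B) * Complex.exp (z * x) := by
        have : Complex.exp ((z + h) * x) = Complex.exp (h * x) * Complex.exp (z * x) := by
          rw [← Complex.exp_add]; ring_nf
        simp only [gaussExpDeriv, hwz, Complex.ofReal_zero, zero_mul, mul_zero, sub_zero, add_zero,
          zero_add, one_mul, smul_eq_mul, this, hA, hB]
        ring
      rw [e1, norm_mul, Complex.norm_exp]
      have hre : (z * (x : ℂ)).re = -(2 * a) * x := by
        rw [Complex.re_mul_ofReal, ha]; ring
      rw [hre]
      have hn : ‖h * (x : ℂ)‖ = ‖h‖ * x := by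
        rw [norm_mul, Complex.norm_real, Real.norm_of_nonneg hx]
      have hexp : Real.exp (‖h‖ * x) ≤ Real.exp (a * x) := by gcongr
      have hA1 : ‖A‖ ≤ ‖h‖ ^ 2 * x ^ 2 * Real.exp (a * x) := by
        have := Complex.norm_exp_sub_sum_le_norm_mul_exp (h * x) 2
        rw [hn, mul_pow] at this
        have e : Complex.exp (h * x) - ∑ m ∈ Finset.range 2, (h * (x : ℂ)) ^ m / m.factorial = A := by
          simp [Finset.sum_range_succ, hA]; ring
        rw [e] at this
        exact this.trans (by gcongr)
      have hB1 : ‖B‖ ≤ ‖h‖ * x * Real.exp (a * x) := by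
        have := Complex.norm_exp_sub_sum_le_norm_mul_exp (h * x) 1
        rw [hn, pow_one] at this
        have e : Complex.exp (h * x) - ∑ m ∈ Finset.range 1, (h * (x : ℂ)) ^ m / m.factorial = B := by
          simp [hB]
        rw [e] at this
        exact this.trans (by gcongr)
      have p2 := pow_mul_exp_le 2 ha0 hx
      have p1 := pow_mul_exp_le 1 ha0 hx
      have ee : Real.exp (a * x) * Real.exp (-(2 * a) * x) = Real.exp (-a * x) := by
        rw [← Real.exp_add]; ring_nf
      calc _ ≤ (‖z‖ * (‖h‖ ^ 2 * x ^ 2 * Real.exp (a * x)) +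
            ‖h‖ * (‖h‖ * x * Real.exp (a * x))) * Real.exp (-(2 * a) * x) := by
            gcongr
            refine (norm_add_le _ _).trans ?_
            rw [norm_mul, norm_mul]
            gcongr
        _ = ‖h‖ ^ 2 * (‖z‖ * (x ^ 2 * (Real.exp (a * x) * Real.exp (-(2 * a) * x))) +
            x ^ 1 * (Real.exp (a * x) * Real.exp (-(2 * a) * x))) := by ring
        _ ≤ ‖h‖ ^ 2 * (‖z‖ * (2 / a ^ 2) + 1 / a) := by
            rw [ee]
            norm_num at p1 p2
            simp only [neg_mul, pow_one, one_div]
            gcongr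
        _ = _ := by ring
    · have hz1 := hdist s hs
      have hw1 : d / 2 ≤ ‖s - w‖ := by
        have : s - z = (s - w) + h := by rw [hh]; ring
        rw [this] at hz1
        have := norm_add_le (s - w) h
        linarith
      have n1 := sub_ne_zero_of_mem_expDomain hw hs
      have n2 := sub_ne_zero_of_mem_expDomain hz hs
      have e : (s - w)⁻¹ - (s - z)⁻¹ - h * ((s - z) ^ 2)⁻¹ = h ^ 2 / ((s - w) * (s - z) ^ 2) := by
        rw [hh]; field_simp; ring
      rw [e, norm_div, norm_mul, norm_pow, norm_pow]
      calc _ ≤ ‖h‖ ^ 2 / (d / 2 * d ^ 2) := by gcongr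
        _ = _ := by field_simp
  rw [hasDerivAt_iff_isLittleO]
  refine (Asymptotics.IsBigO.of_bound C key).trans_isLittleO ?_
  refine Asymptotics.isLittleO_norm_left.1 ?_
  simpa only [norm_pow] using Asymptotics.isLittleO_pow_sub_sub z one_lt_two

/-! The closure of `V_{-∞}` in `V_{α,r}` -/

/-- The closure of `V_{-∞}` in `V_{α,r}`. -/
noncomputable def entireClosure : Submodule ℂ (VRect α r hα hr) :=
  (LinearMap.range (VHalf.toVRect (β := ⊥) α r hα hr (EReal.bot_lt_coe α))).topologicalClosure

lemma isClosed_entireClosure : IsClosed (entireClosure hα hr : Set (VRect α r hα hr)) :=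
  Submodule.isClosed_topologicalClosure _

lemma mem_entireClosure {τ : VRect α r hα hr} (h : τ.1 ∈ halfPlaneSubmodule ⊥) :
    τ ∈ entireClosure hα hr :=
  Submodule.le_topologicalClosure _ ⟨⟨τ.1, h⟩, rfl⟩

/-- The Gaussian-damped exponentials `e^{zx - εx²}` lie in `V_{-∞}` and converge to `e^{zx}` at rate
`O(ε)`. The room between `Re z` and `α` makes this convergence uniform on the rectangle. -/
lemma expo_mem_of_re_lt {z : ℂ} (hz : z.re < α) : expo hα hr z ∈ entireClosure hα hr := by
  have hzd : z ∈ expDomain α r :=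
    ⟨hz.trans hα, fun h => by have := le_re_of_mem_closure_rect h; linarith⟩
  -- The number `-b` is the midpoint of `Re z` and `α`, and `a` is half their distance, so `|e^{zx}|
  -- = e^{-ax} e^{-bx}`. The first factor absorbs the polynomials coming from `|e^{-εx²} - 1| ≤
  -- εx²`; the second keeps the transforms bounded on `Re s ≥ α`.
  set b := -(z.re + α) / 2 with hb
  set a := (α - z.re) / 2 with ha
  have ha0 : 0 < a := by rw [ha]; linarith
  have hzab : z.re = -(a + b) := by rw [ha, hb]; ring
  have hbα : -b < α := by rw [hb]; linarith
  set C := (‖z‖ + 1) * (2 / a ^ 2) + 2 * (1 / a) with hC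
  have hC0 : 0 ≤ C := by positivity
  have hdecay : ∀ ε > 0, IsExpDecay (ε * C) b (gaussExp 1 0 z ε - gaussExp 1 0 z 0)
      (gaussExpDeriv 1 0 z ε - gaussExpDeriv 1 0 z 0) := by
    intro ε hε
    have hfac : ∀ x : ℝ, Complex.exp (z * x - ε * x ^ 2) =
        Complex.exp (z * x) * ((Real.exp (-(ε * x ^ 2)) : ℝ) : ℂ) := by
      intro x
      rw [Complex.ofReal_exp, ← Complex.exp_add]
      push_cast
      ring_nf
    have hE : ∀ x : ℝ, ‖((Real.exp (-(ε * x ^ 2)) : ℝ) : ℂ) - 1‖ ≤ ε * x ^ 2 := by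
      intro x
      have h1 : Real.exp (-(ε * x ^ 2)) ≤ 1 := Real.exp_le_one_iff.2 (by
        have : 0 ≤ ε * x ^ 2 := by positivity
        linarith)
      have h2 := Real.add_one_le_exp (-(ε * x ^ 2))
      rw [← Complex.ofReal_one, ← Complex.ofReal_sub, Complex.norm_real, Real.norm_eq_abs, abs_le]
      constructor <;> nlinarith [sq_nonneg x]
    have hE1 : ∀ x : ℝ, ‖((Real.exp (-(ε * x ^ 2)) : ℝ) : ℂ)‖ ≤ 1 := by
      intro x
      rw [Complex.norm_real, Real.norm_of_nonneg (Real.exp_pos _).le]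
      exact Real.exp_le_one_iff.2 (by
        have : 0 ≤ ε * x ^ 2 := by positivity
        linarith)
    have hz' : ∀ x : ℝ, ‖Complex.exp (z * x)‖ = Real.exp (-a * x) * Real.exp (-b * x) := by
      intro x
      rw [Complex.norm_exp, Complex.re_mul_ofReal, hzab, ← Real.exp_add]
      ring_nf
    have hpoly : ∀ x : ℝ, 0 ≤ x → ((‖z‖ + 1) * x ^ 2 + 2 * x) * Real.exp (-a * x) ≤ C := by
      intro x hx
      have p2 := pow_mul_exp_le 2 ha0 hx
      have p1 := pow_mul_exp_le 1 ha0 hx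
      norm_num at p1 p2
      rw [hC]
      calc _ = (‖z‖ + 1) * (x ^ 2 * Real.exp (-a * x)) + 2 * (x * Real.exp (-a * x)) := by ring
        _ ≤ _ := by
          simp only [neg_mul]
          gcongr
          simpa using p1
    refine ⟨fun x _ => ((hasDerivAt_gaussExp 1 0 z ε x).sub
      (hasDerivAt_gaussExp 1 0 z 0 x)).hasDerivWithinAt,
      ((continuous_gaussExpDeriv 1 0 z ε).sub (continuous_gaussExpDeriv 1 0 z 0)).continuousOn,
      fun x hx => ?_, fun x hx => ?_⟩
    · have e : (gaussExp 1 0 z ε - gaussExp 1 0 z 0) x =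
          (((Real.exp (-(ε * x ^ 2)) : ℝ) : ℂ) - 1) * Complex.exp (z * x) := by
        simp only [Pi.sub_apply, gaussExp, hfac, Complex.ofReal_zero]
        ring_nf
      rw [e, norm_mul, hz']
      calc _ ≤ (ε * x ^ 2) * (Real.exp (-a * x) * Real.exp (-b * x)) := by gcongr; exact hE x
        _ ≤ (ε * ((‖z‖ + 1) * x ^ 2 + 2 * x)) * (Real.exp (-a * x) * Real.exp (-b * x)) := by
            gcongr
            nlinarith [mul_nonneg (norm_nonneg z) (sq_nonneg x)]
        _ = ε * (((‖z‖ + 1) * x ^ 2 + 2 * x) * Real.exp (-a * x)) * Real.exp (-b * x) := by ring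
        _ ≤ _ := by gcongr; exact hpoly x hx
    · have e : (gaussExpDeriv 1 0 z ε - gaussExpDeriv 1 0 z 0) x =
          (z * (((Real.exp (-(ε * x ^ 2)) : ℝ) : ℂ) - 1) -
            2 * ε * x * ((Real.exp (-(ε * x ^ 2)) : ℝ) : ℂ)) * Complex.exp (z * x) := by
        simp only [Pi.sub_apply, gaussExpDeriv, hfac, Complex.ofReal_zero]
        ring_nf
      rw [e, norm_mul, hz']
      have h2 : ‖(2 : ℂ) * ε * x‖ = 2 * ε * x := by
        rw [norm_mul, norm_mul, Complex.norm_real, Complex.norm_real, Real.norm_of_nonneg hx,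
          Real.norm_of_nonneg (le_of_lt hε)]
        norm_num
      calc _ ≤ (‖z‖ * (ε * x ^ 2) + 2 * ε * x * 1) * (Real.exp (-a * x) * Real.exp (-b * x)) := by
            gcongr
            refine (norm_sub_le _ _).trans ?_
            rw [norm_mul, norm_mul (2 * (ε : ℂ) * x), h2]
            gcongr
            · exact hE x
            · exact hE1 x
        _ ≤ (ε * ((‖z‖ + 1) * x ^ 2 + 2 * x)) * (Real.exp (-a * x) * Real.exp (-b * x)) := by
            gcongr
            nlinarith [mul_nonneg (le_of_lt hε) (sq_nonneg x)]
        _ = ε * (((‖z‖ + 1) * x ^ 2 + 2 * x) * Real.exp (-a * x)) * Real.exp (-b * x) := by ring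
        _ ≤ _ := by gcongr; exact hpoly x hx
  refine (isClosed_entireClosure hα hr).mem_of_frequently_of_tendsto (b := 𝓝[>] (0 : ℝ))
    (f := fun ε => if h : 0 < ε then VRect.of (restrict (gaussExp 1 0 z ε))
      (halfPlaneSubmodule_le_rectSubmodule (EReal.bot_lt_coe α) r (gaussExp_mem 1 0 z h)) else 0) (Eventually.frequently ?_) ?_
  · filter_upwards [self_mem_nhdsWithin] with ε (hε : 0 < ε)
    rw [dif_pos hε]
    exact mem_entireClosure hα hr (gaussExp_mem 1 0 z hε)
  · rw [tendsto_iff_norm_sub_tendsto_zero]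
    refine squeeze_zero' (Eventually.of_forall fun _ => norm_nonneg _)
      (g := fun ε => ε * C + ε * C / (α + b)) ?_ ?_
    · filter_upwards [self_mem_nhdsWithin] with ε (hε : 0 < ε)
      rw [dif_pos hε]
      refine norm_le_of_isExpDecay (hdecay ε hε) ?_ hbα
      rw [← restrict_sub, ← expo_val hα hr hzd]
      rfl
    · have : Tendsto (fun ε : ℝ => ε * C + ε * C / (α + b)) (𝓝 0) (𝓝 (0 * C + 0 * C / (α + b))) := by
        apply Continuous.tendsto; fun_prop
      simp only [zero_mul, zero_div, add_zero] at this
      exact this.mono_left nhdsWithin_le_nhds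

instance : IsClosed (entireClosure hα hr : Set (VRect α r hα hr)) := isClosed_entireClosure hα hr

/-- The identity theorem in the quotient by the closure of `V_{-∞}`: the class of `e^{zx}` is
holomorphic in `z` and vanishes near `w`, hence on all of the connected set `U`. -/
lemma expo_mem_of_convex {U : Set ℂ} (hU : Convex ℝ U) (hUo : IsOpen U) (hUd : U ⊆ expDomain α r)
    {w : ℂ} (hw : w ∈ U) (hwα : w.re < α) {z : ℂ} (hz : z ∈ U) :
    expo hα hr z ∈ entireClosure hα hr := by
  set q := (entireClosure hα hr).mkQL with hq
  have hd : DifferentiableOn ℂ (fun z => q (expo hα hr z)) U := fun z hz =>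
    (q.hasFDerivAt.comp_hasDerivAt z
      (hasDerivAt_expo hα hr (hUd hz))).differentiableAt.differentiableWithinAt
  have h0 : EqOn (fun z => q (expo hα hr z)) 0 U := by
    refine (hd.analyticOnNhd hUo).eqOn_zero_of_preconnected_of_eventuallyEq_zero
      hU.isPreconnected hw ?_
    filter_upwards [(isOpen_lt Complex.continuous_re continuous_const).mem_nhds hwα] with v hv
    exact (Submodule.Quotient.mk_eq_zero _).2 (expo_mem_of_re_lt hα hr hv)
  exact (Submodule.Quotient.mk_eq_zero _).1 (h0 hz)

/-- All the exponentials in `V_{α,r}` lie in the closure of `V_{-∞}`. -/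
lemma expo_mem {z : ℂ} (hz : z ∈ expDomain α r) : expo hα hr z ∈ entireClosure hα hr := by
  have hcl := closure_rect hα hr
  have hα1 : ∀ y : ℝ, (⟨α - 1, y⟩ : ℂ).re < α := fun y => by show α - 1 < α; linarith
  have hleft : Convex ℝ {w : ℂ | w.re < 0} := convex_halfSpace_re_lt 0
  have hleft' : IsOpen {w : ℂ | w.re < 0} := isOpen_lt Complex.continuous_re continuous_const
  -- Admissible exponents have `Re z < α` or lie in one of the two quadrants `Re z < 0`, `±Im z >
  -- r`. Each quadrant is convex and reaches into `Re z < α`.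
  by_cases h1 : z.re < α
  · exact expo_mem_of_re_lt hα hr h1
  by_cases h2 : r < z.im
  · refine expo_mem_of_convex hα hr (hleft.inter (convex_halfSpace_im_gt r))
      (hleft'.inter (isOpen_lt continuous_const Complex.continuous_im)) ?_
      (w := ⟨α - 1, r + 1⟩) ⟨?_, ?_⟩ (hα1 _) ⟨hz.1, h2⟩
    · rintro w ⟨hw1, hw2 : r < w.im⟩
      refine ⟨hw1, fun h => ?_⟩
      rw [hcl] at h
      have := (abs_le.1 h.2.2).2
      linarith
    · show α - 1 < 0; linarith
    · show r < r + 1; linarith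
  by_cases h3 : z.im < -r
  · refine expo_mem_of_convex hα hr (hleft.inter (convex_halfSpace_im_lt (-r)))
      (hleft'.inter (isOpen_lt Complex.continuous_im continuous_const)) ?_
      (w := ⟨α - 1, -r - 1⟩) ⟨?_, ?_⟩ (hα1 _) ⟨hz.1, h3⟩
    · rintro w ⟨hw1, hw2 : w.im < -r⟩
      refine ⟨hw1, fun h => ?_⟩
      rw [hcl] at h
      have := (abs_le.1 h.2.2).1
      linarith
    · show α - 1 < 0; linarith
    · show -r - 1 < -r; linarith
  · refine absurd ?_ hz.2
    rw [hcl]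
    have := hz.1
    exact ⟨by linarith, by linarith, abs_le.2 ⟨by linarith, by linarith⟩⟩

end exponential

/-! ### Causal functions and Laplace inversion -/

/-- `f` is `C¹` on `ℝ` with derivative `f'`, vanishes on `(-∞, 0]`, and both `f` and `f'` are
`O(e^{-δx})`. -/
structure IsCausal (δ : ℝ) (f f' : ℝ → ℂ) : Prop where
  hasDeriv : ∀ x, HasDerivAt f (f' x) x
  cont : Continuous f'
  zero : ∀ x, x ≤ 0 → f x = 0
  zero' : ∀ x, x ≤ 0 → f' x = 0
  bound : ∃ C, ∀ x, ‖f x‖ ≤ C * Real.exp (-δ * x) ∧ ‖f' x‖ ≤ C * Real.exp (-δ * x)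

/-- The domain `R_{α,r} ∪ {Re s > -δ}`. -/
def rectUnion (α r δ : ℝ) : Set ℂ := rect α r ∪ {s | -δ < s.re}

/-- `F` is an analytic continuation of the Laplace integral of `f` from `{Re s > -δ}` to
`R_{α,r} ∪ {Re s > -δ}`. -/
def IsUnionExt (α r δ : ℝ) (f F : ℝ → ℂ) (G : ℂ → ℂ) : Prop :=
  IsCausal δ f F ∧ DifferentiableOn ℂ G (rectUnion α r δ) ∧ ∀ s : ℂ, -δ < s.re → G s = halfLap f s

lemma halfLap_eq_integral {f : ℝ → ℂ} (h : ∀ x, x ≤ 0 → f x = 0) (s : ℂ) :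
    halfLap f s = ∫ x : ℝ, f x * Complex.exp (-s * x) :=
  setIntegral_eq_integral_of_forall_compl_eq_zero fun x hx => by
    rw [h x (not_lt.1 hx), zero_mul]

lemma integrable_mul_exp {f : ℝ → ℂ} {C b : ℝ} (hf : Continuous f) (h : ∀ x, x ≤ 0 → f x = 0)
    (hb : ∀ x, ‖f x‖ ≤ C * Real.exp (-b * x)) {s : ℂ} (hs : -b < s.re) :
    Integrable (fun x : ℝ => f x * Complex.exp (-s * x)) := by
  refine (integrableOn_iff_integrable_of_support_subset ?_).1
    (integrableOn_mul_exp hf.continuousOn (fun x _ => hb x) hs)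
  intro x hx
  by_contra h0
  exact hx (by simp only [h x (not_lt.1 h0), zero_mul])

namespace IsCausal

variable {δ : ℝ} {f f' : ℝ → ℂ}

lemma continuous (h : IsCausal δ f f') : Continuous f :=
  continuous_iff_continuousAt.2 fun x => (h.hasDeriv x).continuousAt

lemma exists_isExpDecay (h : IsCausal δ f f') : ∃ C, IsExpDecay C δ f f' := by
  obtain ⟨C, hC⟩ := h.bound
  exact ⟨C, fun x _ => (h.hasDeriv x).hasDerivWithinAt, h.cont.continuousOn,
    fun x _ => (hC x).1, fun x _ => (hC x).2⟩

lemma isSlow (h : IsCausal δ f f') (hδ : 0 < δ) : IsSlow (restrict f) :=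
  h.exists_isExpDecay.choose_spec.isSlow hδ

/-- Integration by parts over the whole line; there is no boundary term at `0` because `f` and `f'`
vanish on the negative axis. -/
lemma mul_halfLap (h : IsCausal δ f f') {s : ℂ} (hs : -δ < s.re) :
    s * halfLap f s = halfLap f' s := by
  obtain ⟨C, hC⟩ := h.bound
  have hi := integrable_mul_exp h.continuous h.zero (fun x => (hC x).1) hs
  have hi' := integrable_mul_exp h.cont h.zero' (fun x => (hC x).2) hs
  have hd : ∀ x : ℝ, HasDerivAt (fun x : ℝ => f x * Complex.exp (-s * x))
      (f' x * Complex.exp (-s * x) - s * (f x * Complex.exp (-s * x))) x := by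
    intro x
    have h2 : HasDerivAt (fun x : ℝ => Complex.exp (-s * x)) (Complex.exp (-s * x) * (-s * 1)) x :=
      ((Complex.ofRealCLM.hasDerivAt (x := x)).const_mul (-s)).cexp
    refine ((h.hasDeriv x).mul h2).congr_deriv ?_
    ring
  have key := integral_eq_zero_of_hasDerivAt_of_integrable hd (hi'.sub (hi.const_mul s)) hi
  rw [integral_sub hi' (hi.const_mul s), integral_const_mul, ← halfLap_eq_integral h.zero,
    ← halfLap_eq_integral h.zero'] at key
  linear_combination -key

end IsCausal

/-- Laplace inversion on the line `Re z = -c`. -/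
lemma integral_halfLap_mul_exp {g : ℝ → ℂ} {C δ c : ℝ} (hg : Continuous g)
    (h0 : ∀ x, x ≤ 0 → g x = 0) (hb : ∀ x, ‖g x‖ ≤ C * Real.exp (-δ * x)) (hc : c < δ)
    (hi : Integrable fun y : ℝ => halfLap g (-c + y * Complex.I)) (x : ℝ) :
    ∫ y : ℝ, halfLap g (-c + y * Complex.I) * Complex.exp ((-c + y * Complex.I) * x) =
      2 * Real.pi * g x := by
  -- Because `c < δ`, the function `g(x) e^{cx}` is integrable. Its Fourier transform at `ξ` is the
  -- Laplace integral of `g` at `-c + 2πiξ`, so Fourier inversion gives the claim after rescaling.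
  set u : ℝ → ℂ := fun x => g x * Complex.exp (c * x) with hu
  have huc : Continuous u := by fun_prop
  have hui : Integrable u := by
    have := integrable_mul_exp hg h0 hb (s := -c) (by simpa using hc)
    simpa [hu] using this
  have hF : ∀ ξ : ℝ, FourierTransform.fourier u ξ =
      halfLap g (-c + (2 * Real.pi * ξ : ℝ) * Complex.I) := by
    intro ξ
    rw [Real.fourier_real_eq_integral_exp_smul, halfLap_eq_integral h0]
    refine integral_congr_ae (Eventually.of_forall fun v => ?_)
    simp only [hu, smul_eq_mul]
    rw [mul_comm, mul_assoc, ← Complex.exp_add]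
    congr 2
    push_cast
    ring
  have h2pi : (2 * Real.pi) ≠ 0 := by positivity
  have hFi : Integrable (FourierTransform.fourier u) := by
    refine (hi.comp_mul_left' h2pi).congr (Eventually.of_forall fun ξ => ?_)
    simp only [hF]
  have key := hui.fourierInv_fourier_eq hFi (v := x) huc.continuousAt
  rw [Real.fourierInv_eq'] at key
  have e : ∀ ξ : ℝ, Complex.exp ((2 * Real.pi * inner ℝ ξ x : ℝ) * Complex.I) •
      FourierTransform.fourier u ξ = (fun y : ℝ => halfLap g (-c + y * Complex.I) *
        Complex.exp ((-c + y * Complex.I) * x) * Complex.exp (c * x)) (2 * Real.pi * ξ) := by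
    intro ξ
    simp only [hF, smul_eq_mul]
    rw [mul_assoc (halfLap g _), ← Complex.exp_add, mul_comm]
    congr 2
    simp only [RCLike.inner_apply, conj_trivial]
    push_cast
    ring
  simp only [e] at key
  rw [Measure.integral_comp_mul_left (fun y : ℝ => halfLap g (-c + y * Complex.I) *
        Complex.exp ((-c + y * Complex.I) * x) * Complex.exp (c * x)) (2 * Real.pi),
    integral_mul_const, hu, abs_of_pos (by positivity), Complex.real_smul, ← mul_assoc] at key
  have key2 := mul_right_cancel₀ (Complex.exp_ne_zero _) key
  rw [← key2]
  rw [← mul_assoc, ← Complex.ofReal_ofNat, ← Complex.ofReal_mul, ← Complex.ofReal_mul,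
    mul_inv_cancel₀ h2pi, Complex.ofReal_one, one_mul]

/-- The quotient map by `M` commutes with the integral and kills the integrand. A non-integrable
function has integral `0`, so integrability need not be assumed. -/
lemma integral_mem_of_forall_mem {E : Type*} [NormedAddCommGroup E] [NormedSpace ℂ E]
    [CompleteSpace E] (M : Submodule ℂ E) [hM : IsClosed (M : Set E)] {μ : Measure ℝ} {φ : ℝ → E}
    (h : ∀ᵐ t ∂μ, φ t ∈ M) : ∫ t, φ t ∂μ ∈ M := by
  by_cases hi : Integrable φ μ
  · refine (Submodule.Quotient.mk_eq_zero M).1 ?_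
    have := M.mkQL.integral_comp_comm hi
    refine this.symm.trans (integral_eq_zero_of_ae ?_)
    filter_upwards [h] with t ht using (Submodule.Quotient.mk_eq_zero M).2 ht
  · rw [integral_undef hi]; exact M.zero_mem

/-- The right part of the closed rectangle, with the edge `Re s = 1`, lies in the half-plane `Re s >
-δ`. Points with `Re s ≤ -δ` are interior to the larger rectangle. -/
lemma isRectExt_of_isUnionExt {α r α₁ r₁ δ : ℝ} (hα : α < 0) (hr : 0 < r) (hα₁ : α₁ < α)
    (hr₁ : r < r₁) (hδ : 0 < δ) {f f' : ℝ → ℂ} {F : ℂ → ℂ} (h : IsUnionExt α₁ r₁ δ f f' F) :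
    IsRectExt α r (restrict f) F := by
  have hcl : closure (rect α r) ⊆ rectUnion α₁ r₁ δ := by
    rw [closure_rect hα hr]
    rintro s ⟨h1, h2, h3⟩
    by_cases hs : -δ < s.re
    · exact Or.inr hs
    · exact Or.inl ⟨by linarith, by linarith, by linarith⟩
  exact ⟨h.2.1.mono (subset_closure.trans hcl), h.2.1.continuousOn.mono hcl,
    fun s _ h0 => (h.2.2 s (by linarith)).trans (laplace_restrict f s).symm⟩

/-! ### Contour integrals of exponentials -/

section contour

variable {α r : ℝ} (hα : α < 0) (hr : 0 < r)

/-- The value of the derivative at `x`, as a continuous linear functional. -/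
noncomputable def evalDeriv (x : ℝ≥0) : VRect α r hα hr →L[ℂ] ℂ :=
  (BoundedContinuousFunction.evalCLM ℂ x).comp VRect.derivL

lemma evalDeriv_apply (x : ℝ≥0) (τ : VRect α r hα hr) : evalDeriv hα hr x τ = hderiv τ.1 x := rfl

lemma evalDeriv_expo (x : ℝ≥0) {z : ℂ} (hz : z ∈ expDomain α r) :
    evalDeriv hα hr x (expo hα hr z) = z * Complex.exp (z * (x : ℝ)) := by
  rw [evalDeriv_apply, expo_val hα hr hz,
    hderiv_restrict x.coe_nonneg (hasDerivAt_gaussExp 1 0 z 0 x).hasDerivWithinAt]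
  simp [gaussExpDeriv]

/-- A causal function with sufficiently smooth Laplace transform is, by Laplace inversion along a
contour around the rectangle, an integral of exponentials. -/
lemma mem_entireClosure_of_decay {α₁ r₁ δ c B : ℝ} (hα₁ : α₁ < α) (hr₁ : r < r₁) (hc : 0 < c)
    (hcδ : c < δ) (hcα : c < -α) {f f' : ℝ → ℂ} {F : ℂ → ℂ} (h : IsUnionExt α₁ r₁ δ f f' F)
    (hB : ∀ y : ℝ, ‖(-c + y * Complex.I) * F (-c + y * Complex.I)‖ ≤ B * (1 + y ^ 2)⁻¹)
    {τ : VRect α r hα hr} (hτ : τ.1 = restrict f) : τ ∈ entireClosure hα hr := by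
  obtain ⟨hf, hFd, hFl⟩ := h
  have hcl := closure_rect hα hr
  set M := entireClosure hα hr with hM
  -- The detour runs halfway between the two rectangles: outside the closed `R_{α,r}`, so that the
  -- exponentials are elements of `V_{α,r}`, and inside `R_{α₁,r₁}`, where `F` is holomorphic.
  set α₂ := (α₁ + α) / 2 with hα₂
  set r₂ := (r + r₁) / 2 with hr₂
  have hUo : IsOpen (rectUnion α₁ r₁ δ) :=
    (isOpen_rect α₁ r₁).union (isOpen_lt continuous_const Complex.continuous_re)
  set E : ℂ → VRect α r hα hr := fun z => F z • expo hα hr z with hE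
  have hEM : ∀ z ∈ expDomain α r, E z ∈ M := fun z hz => M.smul_mem _ (expo_mem hα hr hz)
  have hEc : ContinuousOn E (rectUnion α₁ r₁ δ ∩ expDomain α r) := fun z hz =>
    ((hFd.continuousOn.continuousAt (hUo.mem_nhds hz.1)).smul
      (hasDerivAt_expo hα hr hz.2).continuousAt).continuousWithinAt
  have hEe : ∀ (x : ℝ≥0), ∀ z ∈ expDomain α r,
      evalDeriv hα hr x (E z) = F z * (z * Complex.exp (z * (x : ℝ))) := by
    intro x z hz
    rw [hE, map_smul, evalDeriv_expo hα hr x hz, smul_eq_mul]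
  have hline_re : ∀ t : ℝ, (-c + t * Complex.I : ℂ).re = -c := fun t => by simp
  have hline_im : ∀ t : ℝ, (-c + t * Complex.I : ℂ).im = t := fun t => by simp
  have hlineU : ∀ t : ℝ, (-c + t * Complex.I : ℂ) ∈ rectUnion α₁ r₁ δ := fun t =>
    Or.inr (by show -δ < _; rw [hline_re]; linarith)
  have hray : ∀ t : ℝ, r₂ ≤ |t| → (-c + t * Complex.I : ℂ) ∈ expDomain α r := by
    intro t ht
    refine ⟨by rw [hline_re]; linarith, fun hm => ?_⟩
    rw [hcl] at hm
    have := hm.2.2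
    rw [hline_im] at this
    linarith
  have hleft : ∀ t ∈ uIcc (-r₂) r₂, (α₂ + t * Complex.I : ℂ) ∈
      rectUnion α₁ r₁ δ ∩ expDomain α r := by
    intro t ht
    rw [uIcc_of_le (by linarith)] at ht
    have e1 : (α₂ + t * Complex.I : ℂ).re = α₂ := by simp
    have e2 : (α₂ + t * Complex.I : ℂ).im = t := by simp
    refine ⟨Or.inl ⟨by rw [e1]; linarith, by rw [e1]; linarith, ?_⟩, by rw [e1]; linarith,
      fun hm => ?_⟩
    · rw [e2]
      exact (abs_le.2 ⟨ht.1, ht.2⟩).trans_lt (by linarith)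
    · have := le_re_of_mem_closure_rect hm
      rw [e1] at this
      linarith
  have hhor : ∀ ρ : ℝ, |ρ| = r₂ → ∀ t ∈ uIcc α₂ (-c), (t + ρ * Complex.I : ℂ) ∈
      rectUnion α₁ r₁ δ ∩ expDomain α r := by
    intro ρ hρ t ht
    rw [uIcc_of_le (by linarith)] at ht
    have e1 : (t + ρ * Complex.I : ℂ).re = t := by simp
    have e2 : (t + ρ * Complex.I : ℂ).im = ρ := by simp
    refine ⟨Or.inl ⟨by rw [e1]; linarith [ht.1], by rw [e1]; linarith [ht.2], ?_⟩,
      by rw [e1]; linarith [ht.2], fun hm => ?_⟩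
    · rw [e2, hρ]; linarith
    · rw [hcl] at hm
      have := hm.2.2
      rw [e2, hρ] at this
      linarith
  -- The norm of `e^{zx}` grows like `|z|` along the rays, so integrability in norm is governed by
  -- `z F(z)`, which `hB` controls.
  have hray_int : ∀ S : Set ℝ, MeasurableSet S → (∀ t ∈ S, r₂ ≤ |t|) →
      IntegrableOn (fun t : ℝ => E (-c + t * Complex.I)) S := by
    intro S hS hSr
    have hd : 0 < r₂ - r := by linarith
    refine Integrable.mono' ((integrable_inv_one_add_sq.const_mul
      (B * (1 + (c * (r₂ - r))⁻¹))).integrableOn (s := S)) ?_ ?_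
    · refine ContinuousOn.aestronglyMeasurable (hEc.comp (Continuous.continuousOn (by fun_prop))
        fun t ht => ⟨hlineU t, hray t (hSr t ht)⟩) hS
    · filter_upwards [ae_restrict_mem hS] with t ht
      have hz := hray t (hSr t ht)
      set z : ℂ := -c + t * Complex.I with hzdef
      have hdist : ∀ s ∈ closure (rect α r), r₂ - r ≤ ‖s - z‖ := by
        intro s hs
        rw [hcl] at hs
        have h1 := Complex.abs_im_le_norm (s - z)
        rw [Complex.sub_im, hzdef, hline_im, abs_sub_comm] at h1
        have h2 := abs_sub_abs_le_abs_sub t s.im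
        have := hSr t ht
        linarith [hs.2.2]
      have hcz : c ≤ ‖z‖ := by
        have := Complex.abs_re_le_norm z
        rw [hzdef, hline_re, abs_neg, abs_of_pos hc] at this
        exact this
      have hBt := hB t
      rw [norm_mul] at hBt
      have hFz : ‖F z‖ ≤ B * (1 + t ^ 2)⁻¹ / c := by
        rw [le_div_iff₀ hc, mul_comm]
        exact (mul_le_mul_of_nonneg_right hcz (norm_nonneg _)).trans hBt
      rw [hE, norm_smul]
      calc _ ≤ ‖F z‖ * (‖z‖ + (r₂ - r)⁻¹) := by
            gcongr; exact norm_expo_le hα hr hz hd hdist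
        _ = ‖z‖ * ‖F z‖ + ‖F z‖ * (r₂ - r)⁻¹ := by ring
        _ ≤ B * (1 + t ^ 2)⁻¹ + B * (1 + t ^ 2)⁻¹ / c * (r₂ - r)⁻¹ := by gcongr
        _ = _ := by rw [mul_inv]; ring
  have hseg_int : ∀ (γ : ℝ → ℂ) (a b : ℝ), Continuous γ →
      (∀ t ∈ uIcc a b, γ t ∈ rectUnion α₁ r₁ δ ∩ expDomain α r) →
      IntervalIntegrable (fun t => E (γ t)) volume a b := fun γ a b hγ h =>
    (hEc.comp hγ.continuousOn h).intervalIntegrable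
  have hseg_mem : ∀ (γ : ℝ → ℂ) (a b : ℝ),
      (∀ t ∈ uIcc a b, γ t ∈ rectUnion α₁ r₁ δ ∩ expDomain α r) →
      ∫ t in a..b, E (γ t) ∈ M := by
    intro γ a b h
    rw [intervalIntegral.intervalIntegral_eq_integral_uIoc]
    refine M.smul_of_tower_mem _ (integral_mem_of_forall_mem M ?_)
    filter_upwards [ae_restrict_mem measurableSet_uIoc] with t ht
    exact hEM _ (h t (uIoc_subset_uIcc ht)).2
  have hIic : ∀ t ∈ Iic (-r₂), r₂ ≤ |t| := fun t ht => by
    have := neg_le_abs t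
    have ht : t ≤ -r₂ := ht
    linarith
  have hIoi : ∀ t ∈ Ioi r₂, r₂ ≤ |t| := fun t ht => (le_of_lt ht).trans (le_abs_self t)
  have hr₂0 : 0 < r₂ := by linarith
  have habs : |r₂| = r₂ := abs_of_pos hr₂0
  have habs' : |-r₂| = r₂ := by rw [abs_neg, habs]
  -- The contour follows `Re z = -c` upwards, except that the segment `|Im z| ≤ r₂` is replaced by
  -- the bottom, left and top edges of the detour. The measure is `dz / i`, which gives the
  -- horizontal edges, run leftwards and rightwards, the factors `i` and `-i`.
  set Y : VRect α r hα hr := (∫ t in Iic (-r₂), E (-c + t * Complex.I)) +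
    (∫ t in Ioi r₂, E (-c + t * Complex.I)) + (∫ t in (-r₂)..r₂, E (α₂ + t * Complex.I)) +
    Complex.I • ((∫ t in α₂..(-c), E (t + (-r₂ : ℝ) * Complex.I)) -
      ∫ t in α₂..(-c), E (t + r₂ * Complex.I)) with hY
  have hYM : Y ∈ M := by
    refine M.add_mem (M.add_mem (M.add_mem ?_ ?_) ?_) (M.smul_mem _ (M.sub_mem ?_ ?_))
    · refine integral_mem_of_forall_mem M ?_
      filter_upwards [ae_restrict_mem measurableSet_Iic] with t ht
      exact hEM _ (hray t (hIic t ht))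
    · refine integral_mem_of_forall_mem M ?_
      filter_upwards [ae_restrict_mem measurableSet_Ioi] with t ht
      exact hEM _ (hray t (hIoi t ht))
    · exact hseg_mem _ _ _ hleft
    · exact hseg_mem _ _ _ (hhor _ habs')
    · exact hseg_mem _ _ _ (hhor _ habs)
  have hYτ : Y = (2 * Real.pi : ℂ) • τ := by
    -- Since `derivL` is injective, it suffices to compare derivatives pointwise. Evaluating the
    -- derivative commutes with the integrals and turns `F(z) e^{zx}` into `z F(z) e^{zx}`, the
    -- integrand of the inversion formula for `f'`.
    refine VRect.derivL_injective (BoundedContinuousFunction.ext fun x => ?_)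
    change evalDeriv hα hr x Y = evalDeriv hα hr x ((2 * Real.pi : ℂ) • τ)
    set L := evalDeriv hα hr x with hL
    set k : ℂ → ℂ := fun z => F z * (z * Complex.exp (z * (x : ℝ))) with hk
    have hkd : DifferentiableOn ℂ k (rectUnion α₁ r₁ δ) :=
      hFd.mul (differentiableOn_id.mul (by fun_prop))
    have hsegL : ∀ (γ : ℝ → ℂ) (a b : ℝ), Continuous γ →
        (∀ t ∈ uIcc a b, γ t ∈ rectUnion α₁ r₁ δ ∩ expDomain α r) →
        L (∫ t in a..b, E (γ t)) = ∫ t in a..b, k (γ t) := by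
      intro γ a b hγ h
      rw [← L.intervalIntegral_comp_comm (hseg_int γ a b hγ h)]
      exact intervalIntegral.integral_congr fun t ht => hEe x _ (h t ht).2
    have hrayL : ∀ S : Set ℝ, MeasurableSet S → (∀ t ∈ S, r₂ ≤ |t|) →
        L (∫ t in S, E (-c + t * Complex.I)) = ∫ t in S, k (-c + t * Complex.I) := by
      intro S hS hSr
      rw [← L.integral_comp_comm (hray_int S hS hSr)]
      exact setIntegral_congr_fun hS fun t ht => hEe x _ (hray t (hSr t ht))
    -- The contour is deformed only for this scalar integrand, which is holomorphic across the
    -- rectangle; inside it `e^{zx}` is not an element of `V_{α,r}`.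
    have hrect := Complex.integral_boundary_rect_eq_zero_of_differentiableOn k ⟨α₂, -r₂⟩ ⟨-c, r₂⟩
      (hkd.mono (by
        rintro w ⟨hw1, hw2⟩
        simp only [mem_preimage] at hw1 hw2
        rw [uIcc_of_le (by linarith)] at hw1
        rw [uIcc_of_le (by linarith)] at hw2
        exact Or.inl ⟨by linarith [hw1.1], by linarith [hw1.2],
          (abs_le.2 ⟨hw2.1, hw2.2⟩).trans_lt (by linarith)⟩))
    simp only [smul_eq_mul] at hrect
    have hdef : ∀ t : ℝ, k (-c + t * Complex.I) = halfLap f' (-c + t * Complex.I) *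
        Complex.exp ((-c + t * Complex.I) * (x : ℝ)) := by
      intro t
      have hre : -δ < (-c + t * Complex.I : ℂ).re := by rw [hline_re]; linarith
      rw [← hf.mul_halfLap hre, ← hFl _ hre, hk]
      ring
    obtain ⟨C, hC⟩ := hf.bound
    have hlapc : Continuous fun t : ℝ => halfLap f' (-c + t * Complex.I) := by
      refine (differentiableOn_halfLap (b := δ) hf.cont.continuousOn
        fun x _ => (hC x).2).continuousOn.comp_continuous (by fun_prop) fun t => ?_
      show -δ < _
      rw [hline_re]; linarith
    have hlapi : Integrable fun t : ℝ => halfLap f' (-c + t * Complex.I) := by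
      refine Integrable.mono' (integrable_inv_one_add_sq.const_mul B)
        hlapc.aestronglyMeasurable (Eventually.of_forall fun t => ?_)
      have hre : -δ < (-c + t * Complex.I : ℂ).re := by rw [hline_re]; linarith
      rw [← hf.mul_halfLap hre, ← hFl _ hre]
      exact hB t
    have hinv := integral_halfLap_mul_exp hf.cont hf.zero' (fun x => (hC x).2) hcδ hlapi x
    simp only [← hdef] at hinv
    have hki : Integrable fun t : ℝ => k (-c + t * Complex.I) := by
      simp only [hdef]
      refine Integrable.mono' hlapi.norm (hlapc.mul (by fun_prop)).aestronglyMeasurable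
        (Eventually.of_forall fun t => ?_)
      rw [norm_mul, Complex.norm_exp, Complex.re_mul_ofReal, hline_re]
      refine mul_le_of_le_one_right (norm_nonneg _) (Real.exp_le_one_iff.2 ?_)
      nlinarith [x.coe_nonneg]
    have hsplit := intervalIntegral.integral_Iic_add_Ioi hki.integrableOn hki.integrableOn (b := r₂)
    have hsplit2 := intervalIntegral.integral_Iic_sub_Iic (a := -r₂) (b := r₂)
      hki.integrableOn hki.integrableOn
    rw [hY, map_add, map_add, map_add, map_smul, map_sub, hrayL _ measurableSet_Iic hIic,
      hrayL _ measurableSet_Ioi hIoi, hsegL _ _ _ (by fun_prop) hleft,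
      hsegL _ _ _ (by fun_prop) (hhor _ habs'), hsegL _ _ _ (by fun_prop) (hhor _ habs),
      map_smul, hL, evalDeriv_apply, hτ, hderiv_restrict x.coe_nonneg
        (hf.hasDeriv x).hasDerivWithinAt, smul_eq_mul, smul_eq_mul, ← hinv, ← hsplit]
    push_cast at hrect ⊢
    have hI := Complex.I_mul_I
    linear_combination -hsplit2 + Complex.I * hrect +
      ((∫ t in (-r₂)..r₂, k (α₂ + t * Complex.I)) -
        ∫ t in (-r₂)..r₂, k (-c + t * Complex.I)) * hI
  have hp : (2 * Real.pi : ℂ) ≠ 0 := by simp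
  have hτY : τ = (2 * Real.pi : ℂ)⁻¹ • Y := by rw [hYτ, smul_smul, inv_mul_cancel₀ hp, one_smul]
  rw [hτY]
  exact M.smul_mem _ hYM

end contour

/-! ### Smoothing by box averages -/

/-- The entire function `(1 - e^{-w}) / w`. -/
noncomputable def boxSymbol : ℂ → ℂ := dslope (fun w => 1 - Complex.exp (-w)) 0

lemma mul_boxSymbol (w : ℂ) : w * boxSymbol w = 1 - Complex.exp (-w) := by
  have := sub_smul_dslope (fun w : ℂ => 1 - Complex.exp (-w)) 0 w
  simpa [boxSymbol] using this

lemma boxSymbol_zero : boxSymbol 0 = 1 := by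
  have h : HasDerivAt (fun w : ℂ => 1 - Complex.exp (-w)) (-(Complex.exp (-0) * -1)) 0 :=
    ((hasDerivAt_id (0 : ℂ)).neg.cexp).const_sub 1
  rw [boxSymbol, dslope_same, h.deriv]
  simp

lemma differentiable_boxSymbol : Differentiable ℂ boxSymbol := by
  have h : DifferentiableOn ℂ (fun w : ℂ => 1 - Complex.exp (-w)) univ := by fun_prop
  exact differentiableOn_univ.1 ((Complex.differentiableOn_dslope univ_mem).2 h)

/-- The average of `f` over `[x - ε, x]`. -/
noncomputable def boxAvg (ε : ℝ) (f : ℝ → ℂ) (x : ℝ) : ℂ := (ε : ℂ)⁻¹ * ∫ t in (x - ε)..x, f t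

/-- The derivative of `boxAvg ε f`. -/
noncomputable def boxAvgDeriv (ε : ℝ) (f : ℝ → ℂ) (x : ℝ) : ℂ := (ε : ℂ)⁻¹ * (f x - f (x - ε))

lemma IsCausal.boxAvg {δ ε : ℝ} (hδ : 0 < δ) (hε : 0 < ε) {f f' : ℝ → ℂ} (h : IsCausal δ f f') :
    IsCausal δ (boxAvg ε f) (boxAvgDeriv ε f) := by
  have hfc := h.continuous
  have hnε : ‖(ε : ℂ)⁻¹‖ = ε⁻¹ := by rw [norm_inv, Complex.norm_real, Real.norm_of_nonneg hε.le]
  refine ⟨fun x => ?_, ?_, fun x hx => ?_, fun x hx => ?_, ?_⟩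
  · have h1 : ∀ y, HasDerivAt (fun y => ∫ t in (0 : ℝ)..y, f t) (f y) y := fun y =>
      intervalIntegral.integral_hasDerivAt_right (hfc.intervalIntegrable _ _)
        (hfc.stronglyMeasurableAtFilter _ _) hfc.continuousAt
    have h2 := ((h1 x).sub ((h1 (x - ε)).comp_sub_const x ε)).const_mul (ε : ℂ)⁻¹
    refine h2.congr_of_eventuallyEq (Eventually.of_forall fun y => ?_)
    simp only [LaplaceDensity.boxAvg, Pi.sub_apply]
    rw [intervalIntegral.integral_interval_sub_left (hfc.intervalIntegrable _ _)
      (hfc.intervalIntegrable _ _)]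
  · unfold boxAvgDeriv; fun_prop
  · have : ∫ t in (x - ε)..x, f t = ∫ t in (x - ε)..x, (0 : ℂ) :=
      intervalIntegral.integral_congr fun t ht => by
        rw [uIcc_of_le (by linarith)] at ht
        exact h.zero t (ht.2.trans hx)
    rw [LaplaceDensity.boxAvg, this, intervalIntegral.integral_zero, mul_zero]
  · rw [boxAvgDeriv, h.zero x hx, h.zero (x - ε) (by linarith), sub_zero, mul_zero]
  · obtain ⟨C, hC⟩ := h.bound
    have hC0 : 0 ≤ C := nonneg_of_mul_nonneg_left ((norm_nonneg _).trans (hC 0).1)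
      (Real.exp_pos _)
    have hsh : ∀ x t, x - ε ≤ t → ‖f t‖ ≤ C * Real.exp (δ * ε) * Real.exp (-δ * x) := by
      intro x t ht
      refine (hC t).1.trans ?_
      rw [mul_assoc, ← Real.exp_add]
      gcongr
      nlinarith
    refine ⟨C * Real.exp (δ * ε) * (1 + 2 * ε⁻¹), fun x => ⟨?_, ?_⟩⟩
    · rw [LaplaceDensity.boxAvg, norm_mul, hnε]
      have h1 := intervalIntegral.norm_integral_le_of_norm_le_const (a := x - ε) (b := x) (f := f)
        (C := C * Real.exp (δ * ε) * Real.exp (-δ * x)) (fun t ht => by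
          rw [uIoc_of_le (by linarith)] at ht
          exact hsh x t ht.1.le)
      rw [sub_sub_cancel, abs_of_pos hε] at h1
      calc _ ≤ ε⁻¹ * (C * Real.exp (δ * ε) * Real.exp (-δ * x) * ε) := by gcongr
        _ = C * Real.exp (δ * ε) * 1 * Real.exp (-δ * x) := by field_simp
        _ ≤ _ := by
          gcongr
          have : 0 < ε⁻¹ := by positivity
          linarith
    · rw [boxAvgDeriv, norm_mul, hnε]
      have h1 := hsh x x (by linarith)
      have h2 := hsh x (x - ε) le_rfl
      calc _ ≤ ε⁻¹ * (C * Real.exp (δ * ε) * Real.exp (-δ * x) +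
            C * Real.exp (δ * ε) * Real.exp (-δ * x)) := by
            gcongr; exact (norm_sub_le _ _).trans (add_le_add h1 h2)
        _ = C * Real.exp (δ * ε) * (2 * ε⁻¹) * Real.exp (-δ * x) := by ring
        _ ≤ _ := by gcongr; linarith

lemma halfLap_boxAvgDeriv {δ ε : ℝ} (hε : 0 < ε) {f f' : ℝ → ℂ} (h : IsCausal δ f f') {s : ℂ}
    (hs : -δ < s.re) :
    halfLap (boxAvgDeriv ε f) s = (ε : ℂ)⁻¹ * (1 - Complex.exp (-(ε * s))) * halfLap f s := by
  obtain ⟨C, hC⟩ := h.bound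
  have hi := integrable_mul_exp h.continuous h.zero (fun x => (hC x).1) hs
  have e : ∀ x : ℝ, boxAvgDeriv ε f x * Complex.exp (-s * x) = (ε : ℂ)⁻¹ *
      (f x * Complex.exp (-s * x) - Complex.exp (-(ε * s)) *
        (fun u : ℝ => f u * Complex.exp (-s * u)) (x - ε)) := by
    intro x
    have : Complex.exp (-s * x) = Complex.exp (-(ε * s)) * Complex.exp (-s * (x - ε : ℝ)) := by
      rw [← Complex.exp_add]; push_cast; ring_nf
    simp only [boxAvgDeriv]
    linear_combination -(ε : ℂ)⁻¹ * f (x - ε) * this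
  rw [halfLap_eq_integral (fun x hx => by
    rw [boxAvgDeriv, h.zero x hx, h.zero (x - ε) (by linarith), sub_zero, mul_zero])]
  simp only [e]
  rw [integral_const_mul, integral_sub hi ((hi.comp_sub_right ε).const_mul _), integral_const_mul,
    integral_sub_right_eq_self (fun u : ℝ => f u * Complex.exp (-s * u)) ε,
    ← halfLap_eq_integral h.zero]
  ring

/-- Averaging multiplies the transform by an entire function, so the domain of continuation is kept.
The formula comes from the transform of the derivative after division by `s`; at `s = 0` it follows
by continuity. -/
lemma IsUnionExt.boxAvg {α r δ ε : ℝ} (hδ : 0 < δ) (hε : 0 < ε) {f f' : ℝ → ℂ} {F : ℂ → ℂ}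
    (h : IsUnionExt α r δ f f' F) :
    IsUnionExt α r δ (boxAvg ε f) (boxAvgDeriv ε f) (fun s => F s * boxSymbol (ε * s)) := by
  have hb := h.1.boxAvg hδ hε
  have hεne : (ε : ℂ) ≠ 0 := by exact_mod_cast hε.ne'
  have hm : Differentiable ℂ fun s : ℂ => boxSymbol (ε * s) :=
    differentiable_boxSymbol.comp (differentiable_id.const_mul (ε : ℂ))
  have hne : ∀ s : ℂ, -δ < s.re → s ≠ 0 →
      halfLap f s * boxSymbol (ε * s) = halfLap (LaplaceDensity.boxAvg ε f) s := by
    intro s hs hs0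
    refine mul_left_cancel₀ hs0 ?_
    rw [hb.mul_halfLap hs, halfLap_boxAvgDeriv hε h.1 hs, ← mul_boxSymbol]
    field_simp
  have hcont : ∀ {g g' : ℝ → ℂ}, IsCausal δ g g' → ContinuousAt (halfLap g) 0 := by
    intro g g' hg
    obtain ⟨C, hC⟩ := hg.exists_isExpDecay
    exact (differentiableOn_halfLap hC.continuousOn hC.bound).continuousOn.continuousAt
      ((isOpen_lt continuous_const Complex.continuous_re).mem_nhds (by
        show -δ < (0 : ℂ).re; simpa using hδ))
  refine ⟨hb, h.2.1.mul hm.differentiableOn, fun s hs => ?_⟩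
  change F s * boxSymbol (ε * s) = _
  rw [h.2.2 s hs]
  by_cases hs0 : s = 0
  · subst hs0
    refine (ContinuousAt.eventuallyEq_nhds_iff_eventuallyEq_nhdsNE
      ((hcont h.1).mul hm.continuous.continuousAt) (hcont hb)).1 ?_ |>.eq_of_nhds
    filter_upwards [self_mem_nhdsWithin, nhdsWithin_le_nhds ((isOpen_lt continuous_const
      Complex.continuous_re).mem_nhds hs)] with w hw hw'
    exact hne w hw' hw
  · exact hne s hs hs0

lemma IsCausal.uniformContinuous {δ : ℝ} (hδ : 0 < δ) {f f' : ℝ → ℂ} (h : IsCausal δ f f') :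
    UniformContinuous f' := by
  obtain ⟨C, hC⟩ := h.exists_isExpDecay
  refine h.cont.uniformContinuous_of_tendsto_cocompact (x := 0) ?_
  rw [cocompact_eq_atBot_atTop]
  refine Tendsto.sup ?_ ?_
  · refine tendsto_const_nhds.congr' ?_
    filter_upwards [eventually_le_atBot 0] with x hx using (h.zero' x hx).symm
  · refine (hC.isSlow hδ).2.congr' ?_
    filter_upwards [eventually_ge_atTop 0] with x hx using
      hderiv_restrict hx (h.hasDeriv x).hasDerivWithinAt

section

variable {α r : ℝ} (hα : α < 0) (hr : 0 < r)

/-- The averages converge to `f` in norm as `ε → 0`: the derivatives by uniform continuity of `f'`,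
the transforms because `boxSymbol (ε * s)` tends to `1` uniformly on the compact rectangle. -/
lemma mem_entireClosure_of_boxAvg {α₁ r₁ δ : ℝ} (hα₁ : α₁ < α) (hr₁ : r < r₁) (hδ : 0 < δ)
    {f f' : ℝ → ℂ} {F : ℂ → ℂ} (h : IsUnionExt α₁ r₁ δ f f' F)
    (hM : ∀ ε > 0, ∀ σ : VRect α r hα hr, σ.1 = restrict (boxAvg ε f) → σ ∈ entireClosure hα hr)
    {τ : VRect α r hα hr} (hτ : τ.1 = restrict f) : τ ∈ entireClosure hα hr := by
  have hF := isRectExt_of_isUnionExt hα hr hα₁ hr₁ hδ h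
  obtain ⟨B, hB⟩ := (isCompact_closure_rect α r).exists_bound_of_continuousOn hF.2.1
  obtain ⟨R, hR⟩ := (isCompact_closure_rect α r).exists_bound_of_continuousOn
    (f := id) continuousOn_id
  have hR0 : 0 ≤ R := (norm_nonneg _).trans (hR _ (subset_closure (VRect.half_mem_rect hα hr)))
  have hB0 : 0 ≤ B := (norm_nonneg _).trans (hB _ (subset_closure (VRect.half_mem_rect hα hr)))
  rw [← SetLike.mem_coe, ← (isClosed_entireClosure hα hr).closure_eq]
  refine Metric.mem_closure_iff.2 fun η hη => ?_
  obtain ⟨ρ, hρ, hρ'⟩ := Metric.uniformContinuous_iff.1 (h.1.uniformContinuous hδ) (η / 4)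
    (by positivity)
  obtain ⟨κ, hκ, hκ'⟩ := Metric.continuousAt_iff.1
    (differentiable_boxSymbol.continuous.continuousAt (x := 0)) (η / (4 * (B + 1))) (by positivity)
  set ε := min (ρ / 2) (κ / (R + 1)) with hεdef
  have hε : 0 < ε := by positivity
  have hε1 : ε < ρ := (min_le_left _ _).trans_lt (by linarith)
  have hε2 : ε * (R + 1) ≤ κ := by
    rw [← le_div_iff₀ (by positivity)]; exact min_le_right _ _
  have hu := h.boxAvg hδ hε
  have hG := isRectExt_of_isUnionExt hα hr hα₁ hr₁ hδ hu
  set σ : VRect α r hα hr := VRect.of (restrict (boxAvg ε f)) ⟨hu.1.isSlow hδ, _, hG⟩ with hσ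
  refine ⟨σ, hM ε hε σ rfl, ?_⟩
  rw [dist_comm, dist_eq_norm]
  have hval : (σ - τ).1 = restrict (boxAvg ε f - f) := by
    have : (σ - τ).1 = σ.1 - τ.1 := rfl
    rw [this, hτ]; rfl
  have hext : IsRectExt α r (σ - τ).1 (fun s => F s * boxSymbol (ε * s) - F s) := by
    rw [hval, ← restrict_sub]
    exact hG.sub (hu.1.isSlow hδ) (h.1.isSlow hδ) hF
  refine (VRect.norm_le hext (a := η / 4) (b := η / 4) (fun x hx => ?_) fun s hs => ?_).trans_lt
    (by linarith)
  · rw [hval, hderiv_restrict hx ((hu.1.hasDeriv x).sub (h.1.hasDeriv x)).hasDerivWithinAt]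
    -- The mean value inequality for `f(t) - t f'(x)` on `[x - ε, x]` bounds the difference quotient
    -- of `f` minus `f'(x)`.
    have h1 := Convex.norm_image_sub_le_of_norm_hasDerivWithin_le (C := η / 4)
      (f := fun t : ℝ => f t - t * f' x) (f' := fun t => f' t - 1 * f' x) (s := Icc (x - ε) x)
      (fun t _ => ((h.1.hasDeriv t).sub
        ((Complex.ofRealCLM.hasDerivAt (x := t)).mul_const (f' x))).hasDerivWithinAt)
      (fun t ht => by
        rw [one_mul, ← dist_eq_norm]
        refine (hρ' ?_).le
        rw [Real.dist_eq, abs_lt]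
        constructor <;> linarith [ht.1, ht.2])
      (convex_Icc _ _) (left_mem_Icc.2 (by linarith)) (right_mem_Icc.2 (by linarith))
    rw [sub_sub_cancel, Real.norm_of_nonneg hε.le] at h1
    have hεne : (ε : ℂ) ≠ 0 := by exact_mod_cast hε.ne'
    have e : boxAvgDeriv ε f x - f' x =
        (ε : ℂ)⁻¹ * (f x - x * f' x - (f (x - ε) - (x - ε : ℝ) * f' x)) := by
      rw [boxAvgDeriv]
      push_cast
      field_simp
      ring
    rw [e, norm_mul, norm_inv, Complex.norm_real, Real.norm_of_nonneg hε.le,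
      inv_mul_le_iff₀ hε, mul_comm ε]
    exact h1
  · have e : F s * boxSymbol (ε * s) - F s = F s * (boxSymbol (ε * s) - boxSymbol 0) := by
      rw [boxSymbol_zero]; ring
    have h1 : dist ((ε : ℂ) * s) 0 < κ := by
      rw [dist_zero_right, norm_mul, Complex.norm_real, Real.norm_of_nonneg hε.le]
      have := hR s hs
      simp only [id] at this
      nlinarith
    have h2 := (hκ' h1).le
    rw [dist_eq_norm] at h2
    rw [e, norm_mul]
    calc _ ≤ B * (η / (4 * (B + 1))) := by gcongr; exact hB s hs
      _ ≤ (B + 1) * (η / (4 * (B + 1))) := by gcongr; linarith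
      _ = _ := by field_simp

/-- A causal function whose Laplace transform extends to a neighbourhood of the closed rectangle
is in the closure of `V_{-∞}`. -/
lemma mem_entireClosure_of_isUnionExt {α₁ r₁ δ : ℝ} (hα₁ : α₁ < α) (hr₁ : r < r₁) (hδ : 0 < δ)
    {f f' : ℝ → ℂ} {F : ℂ → ℂ} (h : IsUnionExt α₁ r₁ δ f f' F)
    {τ : VRect α r hα hr} (hτ : τ.1 = restrict f) : τ ∈ entireClosure hα hr := by
  refine mem_entireClosure_of_boxAvg hα hr hα₁ hr₁ hδ h (fun ε hε σ hσ => ?_) hτ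
  have h1 := h.boxAvg hδ hε
  refine mem_entireClosure_of_boxAvg hα hr hα₁ hr₁ hδ h1 (fun ε' hε' σ' hσ' => ?_) hσ
  have h2 := h1.boxAvg hδ hε'
  obtain ⟨C, hC⟩ := h.1.bound
  set c := min δ (-α) / 2 with hc
  have hm : 0 < min δ (-α) := lt_min hδ (by linarith)
  have hc0 : 0 < c := by positivity
  have hcδ : c < δ := by have := min_le_left δ (-α); rw [hc]; linarith
  have hcα : c < -α := by have := min_le_right δ (-α); rw [hc]; linarith
  -- On `Re z = -c` the product `z F(z)` is only bounded, being the transform of `f'`. Each average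
  -- gains a factor `O(1/|z|)`, so two averages give the integrable decay `|z|⁻²`.
  have hsymb : ∀ ε : ℝ, 0 < ε → ∀ z : ℂ, z.re = -c →
      ‖z‖ * ‖boxSymbol (ε * z)‖ ≤ (1 + Real.exp (ε * c)) / ε := by
    intro ε hε z hz
    have e : (ε : ℂ) * (z * boxSymbol (ε * z)) = 1 - Complex.exp (-(ε * z)) := by
      rw [← mul_boxSymbol]; ring
    have h1 : ε * (‖z‖ * ‖boxSymbol (ε * z)‖) ≤ 1 + Real.exp (ε * c) := by
      have e1 : ε * (‖z‖ * ‖boxSymbol (ε * z)‖) = ‖1 - Complex.exp (-(ε * z))‖ := by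
        rw [← e, norm_mul, norm_mul, Complex.norm_real, Real.norm_of_nonneg hε.le]
      rw [e1]
      refine (norm_sub_le _ _).trans ?_
      rw [norm_one, Complex.norm_exp]
      have : (-((ε : ℂ) * z)).re = ε * c := by simp [hz]
      rw [this]
    rw [le_div_iff₀ hε]
    linarith
  set A := (1 + Real.exp (ε * c)) / ε with hA
  set A' := (1 + Real.exp (ε' * c)) / ε' with hA'
  -- On the line `|z|² = c² + y²`, which is at least `min(c², 1) (1 + y²)`.
  set μ := min (c ^ 2) 1 with hμ
  have hμ0 : 0 < μ := by positivity
  refine mem_entireClosure_of_decay hα hr hα₁ hr₁ hc0 hcδ hcα h2 (B := C / (-c + δ) * A * A' / μ)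
    (fun y => ?_) hσ'
  set z : ℂ := -c + y * Complex.I with hz
  have hzre : z.re = -c := by simp [hz]
  have hzim : z.im = y := by simp [hz]
  have hz2 : μ * (1 + y ^ 2) ≤ ‖z‖ ^ 2 := by
    rw [Complex.sq_norm, Complex.normSq_apply, hzre, hzim]
    have h1 : μ ≤ c ^ 2 := min_le_left _ _
    have h2 : μ ≤ 1 := min_le_right _ _
    nlinarith [sq_nonneg y]
  have hre : -δ < z.re := by rw [hzre]; linarith
  have hzF : ‖z * F z‖ ≤ C / (-c + δ) := by
    rw [h.2.2 z hre, h.1.mul_halfLap hre, ← hzre]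
    exact norm_halfLap_le (fun x _ => (hC x).2) hre
  have s1 := hsymb ε hε z hzre
  have s2 := hsymb ε' hε' z hzre
  have hCn : 0 ≤ C / (-c + δ) := (norm_nonneg _).trans hzF
  rw [← div_eq_mul_inv, le_div_iff₀ (by positivity), le_div_iff₀ hμ0]
  calc ‖z * (F z * boxSymbol (ε * z) * boxSymbol (ε' * z))‖ * (1 + y ^ 2) * μ
      = ‖z * F z‖ * ‖boxSymbol (ε * z)‖ * ‖boxSymbol (ε' * z)‖ * (μ * (1 + y ^ 2)) := by
        simp only [norm_mul]; ring
    _ ≤ ‖z * F z‖ * ‖boxSymbol (ε * z)‖ * ‖boxSymbol (ε' * z)‖ * ‖z‖ ^ 2 := by gcongr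
    _ = ‖z * F z‖ * (‖z‖ * ‖boxSymbol (ε * z)‖) * (‖z‖ * ‖boxSymbol (ε' * z)‖) := by ring
    _ ≤ C / (-c + δ) * A * A' := by gcongr

end

/-! Contraction of the Laplace transform towards `s = 1` -/

/-- The function `g((1+δ)x) e^{-δx}`. -/
noncomputable def contract (δ : ℝ) (g : ℝ → ℂ) (x : ℝ) : ℂ :=
  g ((1 + δ) * x) * Complex.exp (-(δ * x))

/-- The derivative of `contract δ g`, if `g'` is the derivative of `g`. -/
noncomputable def contractDeriv (δ : ℝ) (g g' : ℝ → ℂ) (x : ℝ) : ℂ :=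
  ((1 + δ) * g' ((1 + δ) * x) - δ * g ((1 + δ) * x)) * Complex.exp (-(δ * x))

lemma hasDerivAt_contract (δ : ℝ) {g g' : ℝ → ℂ} (h : ∀ x, HasDerivAt g (g' x) x) (x : ℝ) :
    HasDerivAt (contract δ g) (contractDeriv δ g g' x) x := by
  have h0 : HasDerivAt (fun x : ℝ => (1 + δ) * x) ((1 + δ) * 1) x :=
    (hasDerivAt_id x).const_mul (1 + δ)
  have h1 : HasDerivAt (fun x : ℝ => g ((1 + δ) * x)) (((1 + δ) * 1) • g' ((1 + δ) * x)) x :=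
    HasDerivAt.scomp x (h _) h0
  have h2 : HasDerivAt (fun x : ℝ => Complex.exp (-(δ * x)))
      (Complex.exp (-(δ * x)) * -(δ * 1)) x :=
    (((Complex.ofRealCLM.hasDerivAt (x := x)).const_mul (δ : ℂ)).neg).cexp
  refine (h1.mul h2).congr_deriv ?_
  simp only [contractDeriv, Complex.real_smul]
  push_cast
  ring

lemma norm_exp_neg_mul (δ x : ℝ) : ‖Complex.exp (-(δ * x))‖ = Real.exp (-δ * x) := by
  rw [Complex.norm_exp]; simp

section

variable {α r : ℝ} {hα : α < 0} {hr : 0 < r}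

/-- This is `τ(x) = o(x)`: beyond some point the slope is at most `η`, and before it compactness
gives a constant. -/
lemma IsSlow.exists_growth {τ : ℝ≥0 → ℂ} (h : IsSlow τ) {η : ℝ} (hη : 0 < η) :
    ∃ A, 0 ≤ A ∧ ∀ x : ℝ, 0 ≤ x → ‖onReal τ x‖ ≤ A + η * x := by
  obtain ⟨N, hN⟩ := (h.2.norm.eventually_le_const (u := η) (by simpa using hη)).exists_forall_of_atTop
  set N' := max N 0 with hN'
  have hN0 : 0 ≤ N' := le_max_right _ _
  obtain ⟨C, hC⟩ := isCompact_Icc.exists_bound_of_continuousOn (h.1.continuousOn.mono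
    (Icc_subset_Ici_self : Icc (0 : ℝ) N' ⊆ Ici 0))
  have hC0 : 0 ≤ C := (norm_nonneg _).trans (hC 0 ⟨le_rfl, hN0⟩)
  refine ⟨C, hC0, fun x hx => ?_⟩
  rcases le_total x N' with hxN | hxN
  · have := hC x ⟨hx, hxN⟩
    nlinarith
  · have h1 := Convex.norm_image_sub_le_of_norm_hasDerivWithin_le (C := η) (s := Ici N')
      (fun y hy => (h.hasDerivWithinAt (hN0.trans hy)).mono (Ici_subset_Ici.2 hN0))
      (fun y hy => hN y ((le_max_left N 0).trans hy)) (convex_Ici N') self_mem_Ici (mem_Ici.2 hxN)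
    rw [Real.norm_of_nonneg (by linarith)] at h1
    have h2 := norm_sub_norm_le (onReal τ x) (onReal τ N')
    have h3 := hC N' ⟨hN0, le_rfl⟩
    nlinarith

variable {τ : ℝ≥0 → ℂ}

lemma onReal_of_nonpos (h0 : τ 0 = 0) {x : ℝ} (hx : x ≤ 0) : onReal τ x = 0 := by
  rw [onReal, Real.toNNReal_of_nonpos hx, h0]

lemma hderiv_of_nonpos (h0' : hderiv τ 0 = 0) {x : ℝ} (hx : x ≤ 0) : hderiv τ x = 0 := by
  rcases hx.lt_or_eq with hx | rfl
  · exact derivWithin_zero_of_notMem_closure (by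
      rw [closure_Ici]; exact not_le.2 hx)
  · exact h0'

lemma IsSlow.hasDerivAt (h : IsSlow τ) (h0 : τ 0 = 0) (h0' : hderiv τ 0 = 0) (x : ℝ) :
    HasDerivAt (onReal τ) (hderiv τ x) x := by
  rcases lt_trichotomy x 0 with hx | rfl | hx
  · rw [hderiv_of_nonpos h0' hx.le]
    refine (hasDerivAt_const x (0 : ℂ)).congr_of_eventuallyEq ?_
    filter_upwards [Iio_mem_nhds hx] with y hy using onReal_of_nonpos h0 (le_of_lt hy)
  · have h1 : HasDerivWithinAt (onReal τ) (hderiv τ 0) (Iic 0) 0 := by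
      rw [h0']
      exact (hasDerivWithinAt_const (0 : ℝ) _ (0 : ℂ)).congr
        (fun y hy => onReal_of_nonpos h0 hy) (onReal_of_nonpos h0 le_rfl)
    have := (h.hasDerivWithinAt le_rfl).union h1
    rwa [Ici_union_Iic, hasDerivWithinAt_univ] at this
  · exact (h.hasDerivWithinAt hx.le).hasDerivAt (Ici_mem_nhds hx)

lemma IsSlow.continuous_hderiv (h : IsSlow τ) (h0' : hderiv τ 0 = 0) : Continuous (hderiv τ) := by
  have h1 : ContinuousOn (hderiv τ) (Iic 0) :=
    (continuousOn_const (c := (0 : ℂ))).congr fun x hx => hderiv_of_nonpos h0' hx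
  have := h.continuousOn_hderiv.union_of_isClosed h1 isClosed_Ici isClosed_Iic
  rwa [Ici_union_Iic, continuousOn_univ] at this

/-- Vanishing of `τ` and `τ'` at `0` makes the extension by zero `C¹` on `ℝ`. Half of the factor
`e^{-δx}` absorbs the at most linear growth of `τ`, which leaves the rate `δ / 2`. -/
lemma IsSlow.isCausal_contract (h : IsSlow τ) (h0 : τ 0 = 0) (h0' : hderiv τ 0 = 0) {δ : ℝ}
    (hδ : 0 < δ) :
    IsCausal (δ / 2) (contract δ (onReal τ)) (contractDeriv δ (onReal τ) (hderiv τ)) := by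
  have hd := h.hasDerivAt h0 h0'
  have hg : Continuous (onReal τ) := continuous_iff_continuousAt.2 fun x => (hd x).continuousAt
  have hg' := h.continuous_hderiv h0'
  have hneg : ∀ x : ℝ, x ≤ 0 → (1 + δ) * x ≤ 0 := fun x hx =>
    mul_nonpos_of_nonneg_of_nonpos (by linarith) hx
  have hz : ∀ x : ℝ, x ≤ 0 → contract δ (onReal τ) x = 0 := fun x hx => by
    rw [contract, onReal_of_nonpos h0 (hneg x hx), zero_mul]
  have hz' : ∀ x : ℝ, x ≤ 0 → contractDeriv δ (onReal τ) (hderiv τ) x = 0 := fun x hx => by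
    rw [contractDeriv, onReal_of_nonpos h0 (hneg x hx), hderiv_of_nonpos h0' (hneg x hx)]
    simp
  refine ⟨hasDerivAt_contract δ hd, ?_, hz, hz', ?_⟩
  · unfold contractDeriv; fun_prop
  · obtain ⟨A, hA, hAx⟩ := h.exists_growth one_pos
    obtain ⟨M, hM⟩ := h.exists_bound
    have hM0 : 0 ≤ M := (norm_nonneg _).trans (hM 0 le_rfl)
    set K := A + (1 + δ) * (1 / (δ / 2)) with hK
    have hK0 : 0 ≤ K := by positivity
    have hgb : ∀ x : ℝ, 0 ≤ x → ‖onReal τ ((1 + δ) * x)‖ * Real.exp (-δ * x) ≤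
        K * Real.exp (-(δ / 2) * x) := by
      intro x hx
      have p1 := pow_mul_exp_le 1 (half_pos hδ) hx
      simp only [pow_one, Nat.factorial_one, Nat.cast_one] at p1
      have p0 : Real.exp (-(δ / 2) * x) ≤ 1 := Real.exp_le_one_iff.2 (by nlinarith)
      calc _ ≤ (A + 1 * ((1 + δ) * x)) * (Real.exp (-(δ / 2) * x) * Real.exp (-(δ / 2) * x)) := by
            rw [← Real.exp_add]
            have e : -(δ / 2) * x + -(δ / 2) * x = -δ * x := by ring
            rw [e]
            gcongr
            exact hAx _ (by positivity)
        _ = (A * Real.exp (-(δ / 2) * x) + (1 + δ) * (x * Real.exp (-(δ / 2) * x))) *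
            Real.exp (-(δ / 2) * x) := by ring
        _ ≤ (A * 1 + (1 + δ) * (1 / (δ / 2))) * Real.exp (-(δ / 2) * x) := by gcongr
        _ = _ := by rw [hK, mul_one]
    refine ⟨(1 + δ) * M + (1 + δ) * K, fun x => ?_⟩
    rcases le_total x 0 with hx | hx
    · rw [hz x hx, hz' x hx, norm_zero]
      exact ⟨by positivity, by positivity⟩
    have hb := hgb x hx
    have hexp : Real.exp (-δ * x) ≤ Real.exp (-(δ / 2) * x) := by
      gcongr; linarith
    constructor
    · rw [contract, norm_mul, norm_exp_neg_mul]
      refine hb.trans ?_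
      gcongr
      nlinarith [mul_nonneg hδ.le hK0, mul_nonneg hδ.le hM0]
    · rw [contractDeriv, norm_mul, norm_exp_neg_mul]
      have e1 : ‖(1 + δ : ℂ)‖ = 1 + δ := by
        rw [← Complex.ofReal_one, ← Complex.ofReal_add, Complex.norm_real,
          Real.norm_of_nonneg (by linarith)]
      calc _ ≤ ((1 + δ) * M + δ * ‖onReal τ ((1 + δ) * x)‖) * Real.exp (-δ * x) := by
            gcongr
            refine (norm_sub_le _ _).trans ?_
            rw [norm_mul, norm_mul, e1, Complex.norm_real, Real.norm_of_nonneg hδ.le]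
            gcongr
            exact hM _ (by positivity)
        _ = (1 + δ) * M * Real.exp (-δ * x) +
            δ * (‖onReal τ ((1 + δ) * x)‖ * Real.exp (-δ * x)) := by ring
        _ ≤ (1 + δ) * M * Real.exp (-(δ / 2) * x) + δ * (K * Real.exp (-(δ / 2) * x)) := by gcongr
        _ ≤ (1 + δ) * M * Real.exp (-(δ / 2) * x) + (1 + δ) * (K * Real.exp (-(δ / 2) * x)) := by
            gcongr; linarith
        _ = _ := by ring

/-- A change of variables. The map `s ↦ (s + δ) / (1 + δ)` fixes `1` and contracts by `1 / (1 + δ)`,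
so the new transform lives on the rectangle dilated about `1`: its left edge moves to `(1 + δ) α -
δ` and its half-height to `(1 + δ) r`. -/
lemma halfLap_contract (τ : ℝ≥0 → ℂ) {δ : ℝ} (hδ : 0 < δ) (s : ℂ) :
    halfLap (contract δ (onReal τ)) s = (1 + δ : ℂ)⁻¹ * laplace τ ((s + δ) / (1 + δ)) := by
  have h1 : (0 : ℝ) < 1 + δ := by linarith
  have h1c : (1 + δ : ℂ) ≠ 0 := by exact_mod_cast h1.ne'
  have := integral_comp_mul_left_Ioi
    (fun x : ℝ => onReal τ x * Complex.exp (-((s + δ) / (1 + δ)) * x)) 0 h1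
  rw [mul_zero, Complex.real_smul] at this
  push_cast at this
  rw [laplace, ← this, halfLap]
  refine setIntegral_congr_fun measurableSet_Ioi fun x _ => ?_
  simp only [contract]
  rw [mul_assoc, ← Complex.exp_add]
  congr 2
  field_simp
  ring

lemma re_contract {δ : ℝ} (s : ℂ) : ((s + δ) / (1 + δ) : ℂ).re = (s.re + δ) / (1 + δ) := by
  rw [← Complex.ofReal_one, ← Complex.ofReal_add, Complex.div_ofReal_re]; simp

lemma im_contract {δ : ℝ} (s : ℂ) : ((s + δ) / (1 + δ) : ℂ).im = s.im / (1 + δ) := by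
  rw [← Complex.ofReal_one, ← Complex.ofReal_add, Complex.div_ofReal_im]; simp

lemma contract_mem_rect {δ : ℝ} (hδ : 0 < δ) {s : ℂ}
    (hs : s ∈ rect ((1 + δ) * α - δ) ((1 + δ) * r)) : ((s + δ) / (1 + δ) : ℂ) ∈ rect α r := by
  have h1 : (0 : ℝ) < 1 + δ := by linarith
  obtain ⟨a, b, c⟩ := hs
  refine ⟨?_, ?_, ?_⟩
  · rw [re_contract, lt_div_iff₀ h1]; linarith
  · rw [re_contract, div_lt_one h1]; linarith
  · rw [im_contract, abs_div, abs_of_pos h1, div_lt_iff₀ h1]; linarith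

lemma contract_mem_closure (hα : α < 0) (hr : 0 < r) {δ : ℝ} (hδ : 0 < δ) {s : ℂ}
    (hs : s ∈ closure (rect α r)) : ((s + δ) / (1 + δ) : ℂ) ∈ closure (rect α r) := by
  have h1 : (0 : ℝ) < 1 + δ := by linarith
  rw [closure_rect hα hr] at hs ⊢
  obtain ⟨a, b, c⟩ := hs
  refine ⟨?_, ?_, ?_⟩
  · rw [re_contract, le_div_iff₀ h1]; nlinarith
  · rw [re_contract, div_le_one h1]; linarith
  · rw [im_contract, abs_div, abs_of_pos h1, div_le_iff₀ h1]; nlinarith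

lemma rect_subset_contract (hα : α < 0) (hr : 0 < r) {δ : ℝ} (hδ : 0 < δ) :
    rect α r ⊆ rect ((1 + δ) * α - δ) ((1 + δ) * r) := by
  rintro s ⟨a, b, c⟩
  exact ⟨by nlinarith, b, by nlinarith⟩

lemma rectExt_contract (τ : VRect α r hα hr) {δ : ℝ} (hδ : 0 < δ) {s : ℂ}
    (hs : s ∈ rect ((1 + δ) * α - δ) ((1 + δ) * r)) (hre : -δ < s.re) :
    (1 + δ : ℂ)⁻¹ * rectExt α r τ.1 ((s + δ) / (1 + δ)) = halfLap (contract δ (onReal τ.1)) s := by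
  rw [halfLap_contract τ.1 hδ, τ.isRectExt.2.2 _ (contract_mem_rect hδ hs)]
  rw [re_contract]
  have h1 : (0 : ℝ) < 1 + δ := by linarith
  exact div_pos (by linarith) h1

lemma isRectExt_contract (τ : VRect α r hα hr) {δ : ℝ} (hδ : 0 < δ) :
    IsRectExt α r (restrict (contract δ (onReal τ.1)))
      (fun s => (1 + δ : ℂ)⁻¹ * rectExt α r τ.1 ((s + δ) / (1 + δ))) := by
  have hsub := rect_subset_contract hα hr hδ
  refine ⟨?_, ?_, fun s hs h0 => ?_⟩
  · exact (τ.isRectExt.1.comp (by fun_prop) fun s hs =>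
      contract_mem_rect hδ (hsub hs)).const_mul _
  · exact continuousOn_const.mul (τ.isRectExt.2.1.comp (by fun_prop) fun s hs =>
      contract_mem_closure hα hr hδ hs)
  · exact (rectExt_contract τ hδ (hsub hs) (by linarith)).trans (laplace_restrict _ s).symm

/-- The Laplace integral and the pulled-back continuation are glued. They agree on the overlap
because `Re s > -δ` puts `(s + δ) / (1 + δ)` in the right half-plane, where the continuation is the
Laplace integral of `τ`. -/
lemma exists_isUnionExt_contract (τ : VRect α r hα hr) (h0 : τ.1 0 = 0) (h0' : hderiv τ.1 0 = 0)
    {δ : ℝ} (hδ : 0 < δ) : ∃ F, IsUnionExt ((1 + δ) * α - δ) ((1 + δ) * r) (δ / 2)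
      (contract δ (onReal τ.1)) (contractDeriv δ (onReal τ.1) (hderiv τ.1)) F := by
  classical
  set R := rect ((1 + δ) * α - δ) ((1 + δ) * r) with hR
  set f := contract δ (onReal τ.1) with hf
  have hc := τ.2.1.isCausal_contract h0 h0' hδ
  obtain ⟨C, hC⟩ := hc.exists_isExpDecay
  have hHd : DifferentiableOn ℂ (fun s : ℂ => (1 + δ : ℂ)⁻¹ *
      rectExt α r τ.1 ((s + δ) / (1 + δ))) R :=
    (τ.isRectExt.1.comp (by fun_prop) fun s hs => contract_mem_rect hδ hs).const_mul _
  have hLd := differentiableOn_halfLap hC.continuousOn hC.bound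
  have hRo : IsOpen R := isOpen_rect _ _
  have hHo : IsOpen {s : ℂ | -(δ / 2) < s.re} := isOpen_lt continuous_const Complex.continuous_re
  refine ⟨fun s => if -(δ / 2) < s.re then halfLap f s else
    (1 + δ : ℂ)⁻¹ * rectExt α r τ.1 ((s + δ) / (1 + δ)), hc, ?_, fun s hs => if_pos hs⟩
  rintro s (hs | hs)
  · refine ((hHd.differentiableAt (hRo.mem_nhds hs)).congr_of_eventuallyEq
      ?_).differentiableWithinAt
    filter_upwards [hRo.mem_nhds hs] with w hw
    split_ifs with hre
    · exact (rectExt_contract τ hδ hw (by linarith)).symm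
    · rfl
  · refine ((hLd.differentiableAt (hHo.mem_nhds hs)).congr_of_eventuallyEq
      ?_).differentiableWithinAt
    filter_upwards [hHo.mem_nhds hs] with w hw using if_pos hw

/-- On a bounded interval this is joint continuity and compactness. Far out `τ'` is small, and so is
the extra term `δ τ((1+δ)x) e^{-δx}`, because `|τ(y)| ≤ A + κy` with small `κ` and `δx e^{-δx} ≤ 1`.
Mere boundedness of `τ'` would not make this term small uniformly in `x`. -/
lemma IsSlow.eventually_contractDeriv (h : IsSlow τ) (h0 : τ 0 = 0) (h0' : hderiv τ 0 = 0) {η : ℝ}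
    (hη : 0 < η) : ∀ᶠ δ in 𝓝[>] (0 : ℝ), ∀ x : ℝ, 0 ≤ x →
      ‖contractDeriv δ (onReal τ) (hderiv τ) x - hderiv τ x‖ ≤ η := by
  have hd := h.hasDerivAt h0 h0'
  have hg : Continuous (onReal τ) := continuous_iff_continuousAt.2 fun x => (hd x).continuousAt
  have hg' := h.continuous_hderiv h0'
  -- Five copies of `κ` occur below, four from the contracted derivative and one from `hderiv τ x`;
  -- together with `δA ≤ η / 2` they add up to `η`.
  set κ := η / 10 with hκ
  have hκ0 : 0 < κ := by positivity
  obtain ⟨A, hA, hAx⟩ := h.exists_growth hκ0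
  obtain ⟨N, hN⟩ := (h.2.norm.eventually_le_const (u := κ) (by simpa using hκ0)).exists_forall_of_atTop
  have hcpt : ∀ᶠ δ in 𝓝 (0 : ℝ), ∀ x ∈ Icc (0 : ℝ) N,
      ‖contractDeriv δ (onReal τ) (hderiv τ) x - hderiv τ x‖ < η := by
    refine isCompact_Icc.eventually_forall_of_forall_eventually fun y _ => ?_
    have hcont : Continuous fun p : ℝ × ℝ =>
        ‖contractDeriv p.1 (onReal τ) (hderiv τ) p.2 - hderiv τ p.2‖ := by
      unfold contractDeriv; fun_prop
    refine hcont.continuousAt.eventually_lt continuousAt_const ?_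
    simpa [contractDeriv] using hη
  filter_upwards [nhdsWithin_le_nhds hcpt, self_mem_nhdsWithin,
    nhdsWithin_le_nhds (Iio_mem_nhds (one_pos)),
    nhdsWithin_le_nhds (Iio_mem_nhds (show 0 < η / (2 * (A + 1)) by positivity))]
    with δ hδc hδ hδ1 hδA x hx
  have hδ : 0 < δ := hδ
  have hδ1 : δ < 1 := hδ1
  have hδA : δ < η / (2 * (A + 1)) := hδA
  rcases le_total x N with hxN | hxN
  · exact (hδc x ⟨hx, hxN⟩).le
  have hge : x ≤ (1 + δ) * x := by nlinarith
  have b1 := hN x hxN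
  have b2 := hN _ (hxN.trans hge)
  have b3 := hAx _ (hx.trans hge)
  have hE : Real.exp (-δ * x) ≤ 1 := Real.exp_le_one_iff.2 (by nlinarith)
  have hxE : δ * (x * Real.exp (-δ * x)) ≤ 1 := by
    have := pow_mul_exp_le 1 hδ hx
    simp only [pow_one, Nat.factorial_one, Nat.cast_one] at this
    rwa [le_div_iff₀ hδ, mul_comm] at this
  have e1 : ‖(1 + δ : ℂ)‖ = 1 + δ := by
    rw [← Complex.ofReal_one, ← Complex.ofReal_add, Complex.norm_real,
      Real.norm_of_nonneg (by linarith)]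
  have hmain : ‖contractDeriv δ (onReal τ) (hderiv τ) x‖ ≤ 4 * κ + η / 2 := by
    rw [contractDeriv, norm_mul, norm_exp_neg_mul]
    calc _ ≤ ((1 + δ) * κ + δ * (A + κ * ((1 + δ) * x))) * Real.exp (-δ * x) := by
          gcongr
          refine (norm_sub_le _ _).trans ?_
          rw [norm_mul, norm_mul, e1, Complex.norm_real, Real.norm_of_nonneg hδ.le]
          gcongr
      _ = ((1 + δ) * κ + δ * A) * Real.exp (-δ * x) +
          κ * (1 + δ) * (δ * (x * Real.exp (-δ * x))) := by ring
      _ ≤ ((1 + 1) * κ + η / 2) * 1 + κ * (1 + 1) * 1 := by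
          have : δ * A ≤ η / 2 := by
            rw [lt_div_iff₀ (by positivity)] at hδA
            nlinarith
          gcongr
      _ = _ := by ring
  refine (norm_sub_le _ _).trans ?_
  rw [hκ] at *
  linarith

/-- The contracted functions lie in the closure by the contour argument and converge to `τ`. For the
transforms this is uniform continuity on the closed rectangle, where the contraction moves points by
at most `δ(1 + R)`. -/
lemma mem_entireClosure_of_zero (τ : VRect α r hα hr) (h0 : τ.1 0 = 0) (h0' : hderiv τ.1 0 = 0) :
    τ ∈ entireClosure hα hr := by
  rw [← SetLike.mem_coe, ← (isClosed_entireClosure hα hr).closure_eq]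
  refine Metric.mem_closure_iff.2 fun η hη => ?_
  have hK := isCompact_closure_rect α r
  obtain ⟨B, hB⟩ := hK.exists_bound_of_continuousOn τ.isRectExt.2.1
  obtain ⟨R, hR⟩ := hK.exists_bound_of_continuousOn (f := id) continuousOn_id
  have hR0 : 0 ≤ R := (norm_nonneg _).trans (hR _ (subset_closure (VRect.half_mem_rect hα hr)))
  have hB0 : 0 ≤ B := (norm_nonneg _).trans (hB _ (subset_closure (VRect.half_mem_rect hα hr)))
  obtain ⟨ρ, hρ, hρ'⟩ := Metric.uniformContinuousOn_iff.1
    (hK.uniformContinuousOn_of_continuous τ.isRectExt.2.1) (η / 8) (by positivity)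
  obtain ⟨δ, hδd, hδ, hδρ, hδB⟩ := ((τ.2.1.eventually_contractDeriv h0 h0'
    (show 0 < η / 4 by positivity)).and ((eventually_mem_nhdsWithin (s := Ioi (0 : ℝ))).and
    (((eventually_lt_nhds (show 0 < ρ / (1 + R) by positivity)).filter_mono nhdsWithin_le_nhds).and
    ((eventually_lt_nhds (show 0 < η / (8 * (B + 1)) by positivity)).filter_mono
      nhdsWithin_le_nhds)))).exists
  have hδ : 0 < δ := hδ
  have hδρ : δ < ρ / (1 + R) := hδρ
  have hδB : δ < η / (8 * (B + 1)) := hδB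
  rw [lt_div_iff₀ (by positivity)] at hδρ hδB
  obtain ⟨F, hF⟩ := exists_isUnionExt_contract τ h0 h0' hδ
  have hslow := hF.1.isSlow (half_pos hδ)
  have hext := isRectExt_contract τ hδ
  set σ : VRect α r hα hr := VRect.of (restrict (contract δ (onReal τ.1))) ⟨hslow, _, hext⟩ with hσ
  refine ⟨σ, mem_entireClosure_of_isUnionExt hα hr (by nlinarith) (by nlinarith) (half_pos hδ) hF
    rfl, ?_⟩
  rw [dist_comm, dist_eq_norm]
  have hval : (σ - τ).1 = restrict (contract δ (onReal τ.1) - onReal τ.1) := by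
    have : (σ - τ).1 = σ.1 - τ.1 := rfl
    rw [this, ← restrict_sub, restrict_onReal]; rfl
  have hdiff := hext.sub hslow τ.2.1 τ.isRectExt
  have hval2 : (σ - τ).1 = restrict (contract δ (onReal τ.1)) - τ.1 := rfl
  rw [← hval2] at hdiff
  refine (VRect.norm_le hdiff (a := η / 4) (b := η / 4) (fun x hx => ?_) fun s hs => ?_).trans_lt
    (by linarith)
  · rw [hval, hderiv_restrict hx ((hF.1.hasDeriv x).sub
      (τ.2.1.hasDerivAt h0 h0' x)).hasDerivWithinAt]
    exact hδd x hx
  · have h1 : (0 : ℝ) < 1 + δ := by linarith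
    have h1c : (1 + δ : ℂ) ≠ 0 := by exact_mod_cast h1.ne'
    have hn : ‖(1 + δ : ℂ)⁻¹‖ = (1 + δ)⁻¹ := by
      rw [norm_inv, ← Complex.ofReal_one, ← Complex.ofReal_add, Complex.norm_real,
        Real.norm_of_nonneg h1.le]
    have hinv1 : (1 + δ)⁻¹ ≤ 1 := inv_le_one_of_one_le₀ (by linarith)
    set w : ℂ := (s + δ) / (1 + δ) with hw
    have hws : dist w s < ρ := by
      have e : w - s = (1 + δ : ℂ)⁻¹ * (δ * (1 - s)) := by rw [hw]; field_simp; ring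
      rw [dist_eq_norm, e, norm_mul, hn, norm_mul, Complex.norm_real, Real.norm_of_nonneg hδ.le]
      have h2 : ‖(1 : ℂ) - s‖ ≤ 1 + R := by
        refine (norm_sub_le _ _).trans ?_
        rw [norm_one]
        have := hR s hs
        simp only [id] at this
        linarith
      calc _ ≤ 1 * (δ * (1 + R)) := by gcongr
        _ < ρ := by linarith
    have h3 := (hρ' w (contract_mem_closure hα hr hδ hs) s hs hws).le
    rw [dist_eq_norm] at h3
    have e : (1 + δ : ℂ)⁻¹ * rectExt α r τ.1 w - rectExt α r τ.1 s =
        (1 + δ : ℂ)⁻¹ * ((rectExt α r τ.1 w - rectExt α r τ.1 s) - δ * rectExt α r τ.1 s) := by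
      field_simp
      ring
    rw [e, norm_mul, hn]
    calc _ ≤ 1 * (η / 8 + δ * B) := by
          gcongr
          refine (norm_sub_le _ _).trans ?_
          rw [norm_mul, Complex.norm_real, Real.norm_of_nonneg hδ.le]
          gcongr
          exact hB s hs
      _ ≤ η / 4 := by nlinarith

/-- The function `(τ(0) + τ'(0) x) e^{-x²}` belongs to `V_{-∞}` and has the value and slope of `τ`
at `0`, so subtracting it reduces to the case of vanishing initial data. -/
lemma mem_entireClosure_of_all (τ : VRect α r hα hr) : τ ∈ entireClosure hα hr := by
  set f := gaussExp (τ.1 0) (hderiv τ.1 0) 0 1 with hf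
  have hmem := gaussExp_mem (τ.1 0) (hderiv τ.1 0) 0 one_pos
  set σ : VRect α r hα hr := VRect.of (restrict f)
    (halfPlaneSubmodule_le_rectSubmodule (EReal.bot_lt_coe α) r hmem) with hσ
  have hσM : σ ∈ entireClosure hα hr := mem_entireClosure hα hr hmem
  have h0 : (τ - σ).1 0 = 0 := by
    have : (τ - σ).1 0 = τ.1 0 - restrict f 0 := rfl
    rw [this]
    simp [restrict, hf, gaussExp]
  have h0' : hderiv (τ - σ).1 0 = 0 := by
    have h1 : evalDeriv hα hr 0 (τ - σ) = hderiv τ.1 0 - hderiv (restrict f) 0 := by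
      rw [map_sub]; rfl
    rw [evalDeriv_apply, NNReal.coe_zero] at h1
    rw [h1, hderiv_restrict le_rfl (hasDerivAt_gaussExp _ _ 0 1 0).hasDerivWithinAt]
    simp [gaussExpDeriv]
  have := (entireClosure hα hr).add_mem (mem_entireClosure_of_zero (τ - σ) h0 h0') hσM
  rwa [sub_add_cancel] at this

end

/-! ### Monotonicity of the norms and density -/

lemma IsRectExt.mono {α α' r r' : ℝ} (hα : α ≤ α') (hr : r' ≤ r) {τ : ℝ≥0 → ℂ} {F : ℂ → ℂ}
    (h : IsRectExt α r τ F) : IsRectExt α' r' τ F := by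
  have hsub : rect α' r' ⊆ rect α r := fun s hs =>
    ⟨hα.trans_lt hs.1, hs.2.1, hs.2.2.trans_le hr⟩
  exact ⟨h.1.mono hsub, h.2.1.mono (closure_mono hsub), fun s hs => h.2.2 s (hsub hs)⟩

/-- By uniqueness, the continuation to the larger rectangle restricts to that on the smaller one.
Hence the norms grow with the rectangle, and an exhausting sequence of rectangles controls the
topology of `V_α`. -/
lemma VRect.norm_le_of_le {α α' r r' : ℝ} {hα : α < 0} {hr : 0 < r} {hα' : α' < 0} {hr' : 0 < r'}
    (h : α ≤ α') (h' : r' ≤ r) {τ : VRect α r hα hr} {σ : VRect α' r' hα' hr'} (e : σ.1 = τ.1) :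
    ‖σ‖ ≤ ‖τ‖ := by
  have hext := τ.isRectExt.mono h h'
  rw [← e] at hext
  have hsub : rect α' r' ⊆ rect α r := fun s hs => ⟨h.trans_lt hs.1, hs.2.1, hs.2.2.trans_le h'⟩
  refine add_le_add (ciSup_le fun x => ?_) (Real.iSup_le (fun s => ?_) (Real.iSup_nonneg fun _ =>
    norm_nonneg _))
  · rw [e]; exact le_ciSup τ.2.1.bddAbove x
  · rw [hext.rectExt_eqOn s.2, e]
    exact le_ciSup (bddAbove_rectExt τ.2) ⟨s.1, closure_mono hsub s.2⟩

/-- `V_{-∞}` is dense in `V_{α,r}`. -/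
lemma denseRange_toVRect {α r : ℝ} (hα : α < 0) (hr : 0 < r) :
    Dense (range (VHalf.toVRect (β := ⊥) α r hα hr (EReal.bot_lt_coe α))) :=
  fun τ => mem_entireClosure_of_all τ

/-- `V_{-∞}` is dense in `V_α`. -/
lemma denseRange_incl {α : ℝ} (hα : α < 0) :
    Dense (range (VHalf.incl (β₁ := ⊥) (β₂ := (α : EReal)) bot_le)) := by
  intro σ
  -- The left edges decrease to `α`. The shift `n + 2` keeps them strictly negative also for `n =
  -- 0`.
  set a : ℕ → ℝ := fun n => α + -α * (1 / ((n : ℝ) + 2)) with ha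
  have hlim : Tendsto a atTop (𝓝 α) := by
    have h1 : Tendsto (fun n : ℕ => 1 / ((n : ℝ) + 2)) atTop (𝓝 0) := by
      have := tendsto_one_div_atTop_nhds_zero_nat (𝕜 := ℝ)
      exact (this.comp (tendsto_add_atTop_nat 2)).congr fun n => by simp
    have h2 := (h1.const_mul (-α)).const_add α
    rwa [mul_zero, add_zero] at h2
  have hfrac : ∀ n : ℕ, 0 < 1 / ((n : ℝ) + 2) ∧ 1 / ((n : ℝ) + 2) < 1 := fun n => by
    refine ⟨by positivity, ?_⟩
    rw [div_lt_one (by positivity)]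
    have : (0 : ℝ) ≤ n := n.cast_nonneg
    linarith
  have ha0 : ∀ n, a n < 0 := fun n => by
    have := hfrac n
    simp only [ha]
    nlinarith
  have haα : ∀ n, α < a n := fun n => by
    have := hfrac n
    simp only [ha]
    nlinarith
  have hr : ∀ n : ℕ, (0 : ℝ) < n + 1 := fun n => by positivity
  have happ : ∀ n : ℕ, ∃ ρ : VHalf ⊥,
      ‖VHalf.toVRect (a n) (n + 1) (ha0 n) (hr n) (EReal.coe_lt_coe_iff.2 (haα n))
        (VHalf.incl bot_le ρ - σ)‖ < 1 / ((n : ℝ) + 1) := by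
    intro n
    obtain ⟨_, ⟨ρ, rfl⟩, h⟩ := Metric.mem_closure_iff.1 (denseRange_toVRect (ha0 n) (hr n)
      (VHalf.toVRect (a n) (n + 1) (ha0 n) (hr n) (EReal.coe_lt_coe_iff.2 (haα n)) σ))
      (1 / ((n : ℝ) + 1)) (by positivity)
    refine ⟨ρ, ?_⟩
    rw [dist_comm, dist_eq_norm] at h
    rw [map_sub]
    exact h
  choose ρ hρ using happ
  refine mem_closure_of_tendsto (f := fun n => VHalf.incl (β₂ := (α : EReal)) bot_le (ρ n))
    (b := atTop) ?_ (Eventually.of_forall fun n => ⟨ρ n, rfl⟩)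
  -- The topology is an infimum of induced ones, so convergence is tested in each norm separately;
  -- each is dominated by the `n`-th norm for all large `n`.
  simp only [nhds_iInf, tendsto_iInf, nhds_induced, tendsto_comap_iff]
  intro α' r' hα' hr' h
  rw [tendsto_iff_norm_sub_tendsto_zero]
  have hαα' : α < α' := EReal.coe_lt_coe_iff.1 h
  refine squeeze_zero' (Eventually.of_forall fun _ => norm_nonneg _) ?_
    (tendsto_one_div_add_atTop_nhds_zero_nat (𝕜 := ℝ))
  filter_upwards [hlim.eventually_le_const hαα', eventually_ge_atTop ⌈r'⌉₊] with n hn hnr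
  refine le_trans ?_ (hρ n).le
  have hr'n : r' ≤ n + 1 := (Nat.ceil_le.1 hnr).trans (by linarith)
  exact VRect.norm_le_of_le hn hr'n rfl

end LaplaceDensity

theorem theorem2p1 (α : ℝ) (hα : α < 0) :
    (∀ (r : ℝ) (hr : 0 < r),
      Dense (Set.range
        (LaplaceDensity.VHalf.toVRect (β := ⊥) α r hα hr (EReal.bot_lt_coe α)))) ∧
    Dense (Set.range
      (LaplaceDensity.VHalf.incl (β₁ := ⊥) (β₂ := (α : EReal)) bot_le)) :=
  ⟨fun _ hr => LaplaceDensity.denseRange_toVRect hα hr, LaplaceDensity.denseRange_incl hα⟩
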